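/- Let $\Bbbk$ be a field and let $\Bbbk\langle X\rangle$ be the free associative algebra on the ordered alphabet $X=\{1\prec 2\}$. Order words lexicographically (a proper prefix is smaller). For a word $\alpha$ let $|\alpha|$ be its length and $\alpha(x)$ the number of occurrences of the letter $x$. A nonempty word $\alpha$ is a Lyndon word if $\alpha\prec\gamma\beta$ whenever $\alpha=\beta\gamma$ with $\beta,\gamma$ nonempty; let $\mathcal L$ be the set of Lyndon words. Put $E_x=x$ for $x\in X$, and $E_\alpha=E_\beta E_\gamma-E_\gamma E_\beta$ for $\alpha\in\mathcal L\setminus X$, where $\alpha=\beta\gamma$ with $\beta,\gamma\in\mathcal L$ and $\gamma$ as long as possible. For $i,j\ge 0$ let $\mathcal{SH}_{i,j}=\mathcal{SH}_{i,j}(E_2,E_1)$ be the sum of all words with exactly $i$ letters $E_2$ and $j$ letters $E_1$, so that $(E_1+E_2)^d=\sum_{i+j=d}\mathcal{SH}_{i,j}$. The monomials $E_{\alpha_1}^{t_1}\cdots E_{\alpha_n}^{t_n}$ with $n\ge 0$, $\alpha_k\in\mathcal L$, $\alpha_1\succ\cdots\succ\alpha_n$ and $t_k\ge 1$ form a $\Bbbk$-basis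 of $\Bbbk\langle X\rangle$. For $\alpha\in\mathcal L$, let $C_{E_\alpha}$ be defined recursively by $$C_{E_\alpha}=\frac{(|\alpha|-1)!}{\prod_{c}(|\beta_c|!)^{a_c}\,a_c!}\prod_c C_{E_{\beta_c}}^{a_c},$$ where $\alpha=x\,\beta_1^{a_1}\cdots\beta_m^{a_m}$ with $x\in X$, $\beta_c\in\mathcal L$, $\beta_1\succ\cdots\succ\beta_m$ and $a_c\ge1$ (so $C_{E_1}=C_{E_2}=1$). Then $C_{E_\alpha}$ is a natural number, and its image in $\Bbbk$ is the coefficient of $E_\alpha$ in the expansion of $\mathcal{SH}_{\alpha(2),\alpha(1)}$ in the above basis. Moreover, for all $i,j,d\ge 0$, $$\mathcal{SH}_{i,j}=\sum_{\substack{\sum_k t_k\alpha_k(2)=i\\ \sum_k t_k\alpha_k(1)=j}}\frac{(i+j)!}{t_1!\cdots t_n!}\left(\frac{C_{E_{\alpha_1}}E_{\alpha_1}}{|\alpha_1|!}\right)^{t_1}\cdots\left(\frac{C_{E_{\alpha_n}}E_{\alpha_n}}{|\alpha_n|!}\right)^{t_n},$$ $$(E_1+E_2)^d=\sum_{\sum_k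 t_k|\alpha_k|=d}\frac{d!}{t_1!\cdots t_n!}\left(\frac{C_{E_{\alpha_1}}E_{\alpha_1}}{|\alpha_1|!}\right)^{t_1}\cdots\left(\frac{C_{E_{\alpha_n}}E_{\alpha_n}}{|\alpha_n|!}\right)^{t_n}.$$ The sums are finite and run over all $n\ge0$, all $\alpha_1\succ\cdots\succ\alpha_n$ in $\mathcal L$ and all integers $t_k\ge 1$ satisfying the indicated conditions. The total numerical coefficient $\frac{(\sum_k t_k|\alpha_k|)!}{\prod_k t_k!}\prod_k\left(\frac{C_{E_{\alpha_k}}}{|\alpha_k|!}\right)^{t_k}$ of each monomial $E_{\alpha_1}^{t_1}\cdots E_{\alpha_n}^{t_n}$ is a natural number. If $\operatorname{char}\Bbbk=0$ the two formulas hold literally; if $\operatorname{char}\Bbbk>0$ they hold with this natural number, mapped to $\Bbbk$, as the coefficient of the monomial. -/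

import Mathlib

open scoped Nat

namespace LyndonShirshov

section Words

variable {X : Type*} [LinearOrder X]

/-- A nonempty word that is strictly smaller, in the lexicographic order of `List X` (a proper
prefix is smaller than the word), than all its proper rotations. -/
def IsLyndon (α : List X) : Prop :=
  α ≠ [] ∧ ∀ β γ : List X, β ≠ [] → γ ≠ [] → α = β ++ γ → α < γ ++ β

/-- `α` can be cut after its first `n` letters into two Lyndon words. The least such `n` gives the
standard factorization (the one whose right factor is longest). -/
def IsLyndonCut (α : List X) (n : ℕ) : Prop :=
  0 < n ∧ n < α.length ∧ IsLyndon (α.take n) ∧ IsLyndon (α.drop n)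

open Classical in
/-- The element `E_α` of the free algebra: `E_x = x` for a letter, and `E_α = [E_β, E_γ]` if
`(β, γ)` is the standard factorization of the Lyndon word `α`. (It is `0` on words that are
neither letters nor products of two Lyndon words; only Lyndon words matter.) -/
noncomputable def lsE (k : Type*) [CommRing k] (α : List X) : FreeAlgebra k X :=
  if h : ∃ n, IsLyndonCut α n then
    lsE k (α.take (Nat.find h)) * lsE k (α.drop (Nat.find h))
      - lsE k (α.drop (Nat.find h)) * lsE k (α.take (Nat.find h))
  else
    match α with
    | [x] => FreeAlgebra.ι k x
    | _ => 0
termination_by α.length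
decreasing_by
  all_goals
    obtain ⟨h0, h1, -, -⟩ := Nat.find_spec h
    simp only [List.length_take, List.length_drop]
    omega

/-- `L` is a non-increasing list of Lyndon words with product `w`. -/
def IsLyndonFactorization (w : List X) (L : List (List X)) : Prop :=
  (∀ β ∈ L, IsLyndon β) ∧ L.Pairwise (· ≥ ·) ∧ L.flatten = w

open Classical in
/-- The factorization of `w` into a non-increasing product of Lyndon words. -/
noncomputable def lyndonFactors (w : List X) : List (List X) :=
  if h : ∃ L, IsLyndonFactorization w L then h.choose else []

theorem length_le_of_mem_lyndonFactors {w β : List X} (hβ : β ∈ lyndonFactors w) :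
    β.length ≤ w.length := by
  unfold lyndonFactors at hβ
  split_ifs at hβ with h
  · have h2 := h.choose_spec.2.2
    have h3 : β.length ≤ h.choose.flatten.length := by
      rw [List.length_flatten]
      exact List.single_le_sum (by simp) _ (List.mem_map_of_mem hβ)
    rwa [h2] at h3
  · simp at hβ

/-- The constant `C_{E_α}` of a Lyndon word `α`. If `α = x w` with a letter `x` and
`w = α₁ ⋯ α₁ α₂ ⋯ α₂ ⋯` is the non-increasing product of the distinct Lyndon words `α_c` with
multiplicities `a_c`, then `C_{E_α} = (|α| - 1)! / ∏ ((|α_c|!) ^ a_c * a_c!) * ∏ C_{E_{α_c}} ^ a_c`;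
in particular `C_{E_α} = 1` for a letter. -/
noncomputable def lsConst (α : List X) : ℚ :=
  match α with
  | [] => 0
  | _ :: w =>
    (w.length ! : ℚ) /
        (((lyndonFactors w).map fun β => (β.length ! : ℚ)).prod *
          ∏ β ∈ (lyndonFactors w).toFinset, (((lyndonFactors w).count β) ! : ℚ)) *
      ((lyndonFactors w).attach.map fun β => lsConst β.1).prod
termination_by α.length
decreasing_by
  have := length_le_of_mem_lyndonFactors β.2
  simp only [List.length_cons]
  omega

end Words

/-- Lyndon words over the two-letter alphabet `Fin 2`; here `0` is the first (smaller) letter,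
written `1` on paper, and `1` is the second letter, written `2`. -/
abbrev LyndonWord : Type := {α : List (Fin 2) // IsLyndon α}

/-- `f α₁ ^ T α₁ * ⋯ * f αₙ ^ T αₙ`, where `α₁ > ⋯ > αₙ` is the support of `T`. -/
noncomputable def decreasingProd {A : Type*} [Monoid A] (f : LyndonWord → A)
    (T : LyndonWord →₀ ℕ) : A :=
  ((T.support.sort (· ≥ ·)).map fun α => f α ^ T α).prod

/-- The monomial `E_{α₁} ^ t₁ ⋯ E_{αₙ} ^ tₙ`, `α₁ > ⋯ > αₙ`. -/
noncomputable def lsMonomial (k : Type*) [CommRing k] (T : LyndonWord →₀ ℕ) :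
    FreeAlgebra k (Fin 2) :=
  decreasingProd (fun α => lsE k α.1) T

/-- The number of occurrences of the letter `x` in the word `α₁ ^ t₁ ⋯ αₙ ^ tₙ`. -/
def letterCount (x : Fin 2) (T : LyndonWord →₀ ℕ) : ℕ :=
  T.sum fun α t => t * α.1.count x

/-- The length of the word `α₁ ^ t₁ ⋯ αₙ ^ tₙ`. -/
def totalLength (T : LyndonWord →₀ ℕ) : ℕ :=
  T.sum fun α t => t * α.1.length

/-- `t₁! ⋯ tₙ!`. -/
def factorialProd (T : LyndonWord →₀ ℕ) : ℕ :=
  T.prod fun _ t => t !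

/-- The shuffle type polynomial `SH_{i,j}(y, x)`: the sum of all words in `y` and `x` in which
`y` occurs `i` times and `x` occurs `j` times. A word is a map `w : Fin (i + j) → Fin 2`, with
value `1` for the letter `y` and `0` for the letter `x`. -/
def shufflePoly {A : Type*} [Semiring A] (y x : A) (i j : ℕ) : A :=
  ∑ w : Fin (i + j) → Fin 2 with (List.ofFn w).count 1 = i ∧ (List.ofFn w).count 0 = j,
    ((List.ofFn w).map fun a => if a = 1 then y else x).prod

/-- `SH_{i,j}(E_2, E_1)` in the free algebra. -/
noncomputable def lsSH (k : Type*) [CommRing k] (i j : ℕ) : FreeAlgebra k (Fin 2) :=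
  shufflePoly (lsE k [1]) (lsE k [0]) i j

end LyndonShirshov

/-! The coefficients are computed over ℤ and carried to `k` by `baseChange`. By induction on the
bracketing, E_α is α plus a combination of larger rearrangements of α. Words correspond to multisets
of Lyndon words (Chen, Fox, Lyndon), so the non-increasing products of the E_α are unitriangular
with respect to the words and form a basis over every commutative ring (`pbwBasis`). Let c(s) =
`powCoeff s` be the coefficient of the monomial of a multiset s in the power of E_1 + E_2 of
matching degree. Two relations determine c.

Straightening (`repr_ι_mul_pbwElt`): if s is the multiset of Lyndon factors of w, then x times the
monomial of s involves no single E_α except E_{xw}, with coefficient 1, when xw is Lyndon. Splitting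
one factor E_1 + E_2 off the power gives c({xw}) = c(s) (`powCoeff_singleton_cons`).

Primitivity: for the coproduct with primitive letters every E_α is primitive, so a monomial is sent
to the sum over the splittings of its multiset, while a power of E_1 + E_2 is sent to its binomial
expansion. Comparing coefficients at E_α ⊗ s gives `count_mul_powCoeff_cons`, which expresses c(s)
through the values c({α}) (`powCoeff_eq`). Inserted into the first relation, this is the recursion
defining `lsConst`.

The coefficients are integers because the basis exists over ℤ, and nonnegative by the closed
formula. Finally SH_{i,j} is the part of the power with fixed letter content, and the expansion of a
word only involves monomials of the same content. -/

namespace LyndonShirshov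

/-! ### Lyndon words and the Chen–Fox–Lyndon factorization. -/

section WordOrder

variable {X : Type*} [LinearOrder X]

theorem append_lt_append_left_iff (u : List X) {s t : List X} : u ++ s < u ++ t ↔ s < t := by
  induction u with
  | nil => simp
  | cons a u ih => simpa [List.cons_lt_cons_iff] using ih

theorem append_le_append_left_iff (u : List X) {s t : List X} : u ++ s ≤ u ++ t ↔ s ≤ t := by
  rw [← not_lt, ← not_lt, append_lt_append_left_iff]

theorem nil_le_word (u : List X) : [] ≤ u :=
  not_lt.1 (List.not_lt_nil u)

theorem le_append_word (u t : List X) : u ≤ u ++ t := by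
  simpa using (append_le_append_left_iff u).2 (nil_le_word t)

/-- If `u < v`, then either `u` is a proper prefix of `v`, or the two words differ at a letter. -/
theorem prefix_or_append_lt_append {u v : List X} (h : u < v) :
    (∃ t, t ≠ [] ∧ v = u ++ t) ∨ ∀ s t, u ++ s < v ++ t := by
  induction u generalizing v with
  | nil =>
    left
    refine ⟨v, ?_, rfl⟩
    rintro rfl
    exact lt_irrefl _ h
  | cons a u ih =>
    cases v with
    | nil => exact absurd h (List.not_lt_nil _)
    | cons b v =>
      rw [List.cons_lt_cons_iff] at h
      rcases h with h | ⟨rfl, h⟩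
      · right
        intro s t
        rw [List.cons_append, List.cons_append, List.cons_lt_cons_iff]
        exact Or.inl h
      · rcases ih h with ⟨t, ht, rfl⟩ | h'
        · exact Or.inl ⟨t, ht, rfl⟩
        · right
          intro s t
          rw [List.cons_append, List.cons_append, List.cons_lt_cons_iff]
          exact Or.inr ⟨rfl, h' s t⟩

theorem append_lt_append_of_length_le {u v : List X} (h : u < v) (hl : v.length ≤ u.length)
    (s t : List X) : u ++ s < v ++ t := by
  rcases prefix_or_append_lt_append h with ⟨r, hr, rfl⟩ | h'
  · rw [List.length_append] at hl
    have := List.length_pos_iff.2 hr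
    omega
  · exact h' s t

/-- A nonempty word is Lyndon iff it is smaller than all its proper nonempty suffixes. -/
theorem isLyndon_iff_lt_suffix {α : List X} :
    IsLyndon α ↔ α ≠ [] ∧ ∀ β γ : List X, β ≠ [] → γ ≠ [] → α = β ++ γ → α < γ := by
  constructor
  · rintro ⟨h0, h⟩
    refine ⟨h0, fun β γ hβ hγ hα => ?_⟩
    by_contra hle
    have hβl := List.length_pos_iff.2 hβ
    have hne : γ ≠ α := by
      intro e
      have := congrArg List.length hα
      rw [← e, List.length_append] at this
      omega
    have hlt : γ < α := lt_of_le_of_ne (not_lt.1 hle) hne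
    rcases prefix_or_append_lt_append hlt with ⟨δ, hδ, e⟩ | h'
    · have h1 : γ ++ δ < γ ++ β := e ▸ h β γ hβ hγ hα
      rw [append_lt_append_left_iff] at h1
      have h2 := h γ δ hγ hδ e
      have hl : β.length ≤ δ.length := by
        have := congrArg List.length hα
        rw [e, List.length_append, List.length_append] at this
        omega
      have h3 := append_lt_append_of_length_le h1 hl γ γ
      rw [← hα] at h3
      exact lt_asymm h2 h3
    · have := h' β []
      rw [List.append_nil] at this
      exact lt_asymm this (h β γ hβ hγ hα)
  · rintro ⟨h0, h⟩
    exact ⟨h0, fun β γ hβ hγ hα => (h β γ hβ hγ hα).trans_le (le_append_word _ _)⟩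

theorem IsLyndon.lt_suffix {β γ : List X} (h : IsLyndon (β ++ γ)) (hβ : β ≠ []) (hγ : γ ≠ []) :
    β ++ γ < γ :=
  (isLyndon_iff_lt_suffix.1 h).2 β γ hβ hγ rfl

theorem isLyndon_singleton (x : X) : IsLyndon [x] := by
  refine ⟨by simp, fun β γ hβ hγ h => ?_⟩
  have := congrArg List.length h
  have h1 := List.length_pos_iff.2 hβ
  have h2 := List.length_pos_iff.2 hγ
  simp only [List.length_singleton, List.length_append] at this
  omega

/-- The product of two Lyndon words `α < β` is a Lyndon word. -/
theorem IsLyndon.append {α β : List X} (hα : IsLyndon α) (hβ : IsLyndon β) (h : α < β) :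
    IsLyndon (α ++ β) := by
  have key : α ++ β < β := by
    rcases prefix_or_append_lt_append h with ⟨δ, hδ, rfl⟩ | h'
    · rw [append_lt_append_left_iff]
      exact hβ.lt_suffix hα.1 hδ
    · simpa using h' β []
  refine isLyndon_iff_lt_suffix.2 ⟨by simp [hα.1], fun u v hu hv e => ?_⟩
  rcases List.append_eq_append_iff.1 e with ⟨t, rfl, rfl⟩ | ⟨t, rfl, rfl⟩
  · rcases eq_or_ne t [] with rfl | ht
    · simpa using key
    · exact key.trans (hβ.lt_suffix ht hv)
  · rcases eq_or_ne t [] with rfl | ht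
    · simpa using key
    · have h1 := hα.lt_suffix hu ht
      exact append_lt_append_of_length_le h1 (by simp) β β

/-- A non-increasing product of Lyndon words which is Lyndon has at most one factor. -/
theorem not_isLyndon_append_flatten {γ : List X} {L : List (List X)} (hγ : IsLyndon γ)
    (hL : ∀ β ∈ L, IsLyndon β) (hle : ∀ β ∈ L, β ≤ γ) (hne : L ≠ []) :
    ¬ IsLyndon (γ ++ L.flatten) := by
  intro h
  obtain ⟨L, l, rfl⟩ : ∃ L' l, L = L' ++ [l] := ⟨_, _, (List.dropLast_append_getLast hne).symm⟩
  have hl : l ∈ L ++ [l] := by simp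
  have h1 : γ ++ (L ++ [l]).flatten = (γ ++ L.flatten) ++ l := by simp
  rw [h1] at h
  have h2 := h.lt_suffix (by simp [hγ.1]) (hL l hl).1
  have h3 := h2.trans_le (hle l hl)
  rw [List.append_assoc] at h3
  exact absurd h3 (not_lt.2 (le_append_word _ _))

/-- The last factor of `L` is a proper suffix, hence exceeds the whole Lyndon word. In the
straightening this allows E_b to stand in front of the merged element. -/
theorem IsLyndon.append_flatten_le {γ b : List X} {L : List (List X)}
    (h : IsLyndon (γ ++ L.flatten)) (hγ : γ ≠ []) (hL : ∀ β ∈ L, IsLyndon β)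
    (hγb : γ ≤ b) (hle : ∀ β ∈ L, β ≤ b) : γ ++ L.flatten ≤ b := by
  rcases eq_or_ne L [] with rfl | hne
  · simpa using hγb
  obtain ⟨L, l, rfl⟩ : ∃ L' l, L = L' ++ [l] := ⟨_, _, (List.dropLast_append_getLast hne).symm⟩
  have hl : l ∈ L ++ [l] := by simp
  have h1 : γ ++ (L ++ [l]).flatten = (γ ++ L.flatten) ++ l := by simp
  rw [h1] at h ⊢
  exact (h.lt_suffix (by simp [hγ]) (hL l hl).1).le.trans (hle l hl)

/-- If the next factor is larger than γ, the two merge into a Lyndon word, which is inserted into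
the remaining list. -/
theorem exists_isLyndonFactorization_append {γ : List X} (hγ : IsLyndon γ)
    {w : List X} {L : List (List X)} (hL : IsLyndonFactorization w L) :
    ∃ L', IsLyndonFactorization (γ ++ w) L' := by
  induction L generalizing γ w with
  | nil =>
    obtain ⟨-, -, rfl⟩ := hL
    exact ⟨[γ], by simpa using hγ, by simp, by simp⟩
  | cons β L ih =>
    obtain ⟨h1, h2, rfl⟩ := hL
    rw [List.pairwise_cons] at h2
    rcases le_or_gt β γ with h | h
    · refine ⟨γ :: β :: L, ?_, ?_, by simp⟩
      · intro δ hδ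
        rcases List.mem_cons.1 hδ with rfl | hδ
        · exact hγ
        · exact h1 δ hδ
      · rw [List.pairwise_cons, List.pairwise_cons]
        refine ⟨fun δ hδ => ?_, h2⟩
        rcases List.mem_cons.1 hδ with rfl | hδ
        · exact h
        · exact (h2.1 δ hδ).trans h
    · have := ih (hγ.append (h1 β (by simp)) h)
        ⟨fun δ hδ => h1 δ (by simp [hδ]), h2.2, rfl⟩
      simpa using this

theorem exists_isLyndonFactorization (w : List X) : ∃ L, IsLyndonFactorization w L := by
  induction w with
  | nil => exact ⟨[], by simp, by simp, by simp⟩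
  | cons x w ih =>
    obtain ⟨L, hL⟩ := ih
    exact exists_isLyndonFactorization_append (isLyndon_singleton x) hL

theorem exists_suffix_le_of_prefix_flatten {a : List X} {L : List (List X)}
    (hL : ∀ β ∈ L, β ≤ a) {v r : List X} (hv : v ≠ []) (h : L.flatten = v ++ r) :
    ∃ u p, v = u ++ p ∧ p ≠ [] ∧ p ≤ a := by
  induction L generalizing v with
  | nil => simp_all
  | cons l L ih =>
    rw [List.flatten_cons] at h
    have hl := hL l (by simp)
    rcases List.append_eq_append_iff.1 h with ⟨t, rfl, ht⟩ | ⟨t, rfl, -⟩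
    · rcases eq_or_ne t [] with rfl | ht0
      · exact ⟨[], l, by simp, by simpa using hv, hl⟩
      · obtain ⟨u, p, rfl, hp, hpa⟩ := ih (fun β hβ => hL β (by simp [hβ])) ht0 ht
        exact ⟨l ++ u, p, by simp, hp, hpa⟩
    · exact ⟨[], v, by simp, hv, (le_append_word _ _).trans hl⟩

/-- The first factor is the longest Lyndon prefix, which yields uniqueness. A longer Lyndon prefix
would end in a nonempty prefix of some later factor; this suffix is at most `l`, whereas it has to
exceed a word beginning with `l`. -/
theorem length_le_of_isLyndon_prefix {l u r : List X} {L : List (List X)}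
    (hle : ∀ β ∈ L, β ≤ l) (hl : l ≠ []) (hu : IsLyndon u) (h : l ++ L.flatten = u ++ r) :
    u.length ≤ l.length := by
  rcases List.append_eq_append_iff.1 h with ⟨t, rfl, ht⟩ | ⟨t, rfl, -⟩
  · rcases eq_or_ne t [] with rfl | ht0
    · simp
    · obtain ⟨v, p, rfl, hp, hpl⟩ := exists_suffix_le_of_prefix_flatten hle ht0 ht
      rw [← List.append_assoc] at hu
      have h1 := (hu.lt_suffix (by simp [hl]) hp).trans_le hpl
      rw [List.append_assoc] at h1
      exact absurd h1 (not_lt.2 (le_append_word _ _))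
  · simp

theorem IsLyndonFactorization.unique {w : List X} {L L' : List (List X)}
    (h : IsLyndonFactorization w L) (h' : IsLyndonFactorization w L') : L = L' := by
  induction L generalizing w L' with
  | nil =>
    obtain ⟨-, -, rfl⟩ := h
    obtain ⟨h1, -, h3⟩ := h'
    cases L' with
    | nil => rfl
    | cons l L' => simp [(h1 l (by simp)).1] at h3
  | cons l L ih =>
    obtain ⟨h1, h2, rfl⟩ := h
    obtain ⟨h1', h2', h3'⟩ := h'
    cases L' with
    | nil => simp [(h1 l (by simp)).1] at h3'
    | cons l' L' =>
      rw [List.pairwise_cons] at h2 h2'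
      rw [List.flatten_cons, List.flatten_cons] at h3'
      have hl := h1 l (by simp)
      have hl' := h1' l' (by simp)
      have ha := length_le_of_isLyndon_prefix h2.1 hl.1 hl' h3'.symm
      have hb := length_le_of_isLyndon_prefix h2'.1 hl'.1 hl h3'
      obtain ⟨rfl, e⟩ := List.append_inj h3' (le_antisymm ha hb)
      rw [ih ⟨fun β hβ => h1 β (by simp [hβ]), h2.2, rfl⟩
        ⟨fun β hβ => h1' β (by simp [hβ]), h2'.2, e⟩]

theorem lyndonFactors_spec (w : List X) : IsLyndonFactorization w (lyndonFactors w) := by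
  unfold lyndonFactors
  rw [dif_pos (exists_isLyndonFactorization w)]
  exact (exists_isLyndonFactorization w).choose_spec

theorem IsLyndonFactorization.eq_lyndonFactors {w : List X} {L : List (List X)}
    (h : IsLyndonFactorization w L) : L = lyndonFactors w :=
  h.unique (lyndonFactors_spec w)

theorem isLyndonCut_append {β γ : List X} (hβ : IsLyndon β) (hγ : IsLyndon γ) :
    IsLyndonCut (β ++ γ) β.length :=
  ⟨List.length_pos_iff.2 hβ.1, by
    simpa [List.length_pos_iff] using hγ.1, by simpa using hβ, by simpa using hγ⟩

/-- Since the product is Lyndon, γ is smaller than the next factor and absorbs it; the cut is found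
just before the last factor is absorbed. -/
theorem exists_isLyndonCut_append_flatten {γ : List X} {L : List (List X)} (hγ : IsLyndon γ)
    (hL : ∀ β ∈ L, IsLyndon β) (hs : L.Pairwise (· ≥ ·)) (hne : L ≠ [])
    (h : IsLyndon (γ ++ L.flatten)) : ∃ n, IsLyndonCut (γ ++ L.flatten) n := by
  induction L generalizing γ with
  | nil => exact absurd rfl hne
  | cons β L ih =>
    rcases eq_or_ne L [] with rfl | hL0
    · simpa using ⟨_, isLyndonCut_append hγ (hL β (by simp))⟩
    · rw [List.pairwise_cons] at hs
      have hlt : γ < β := by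
        by_contra hle
        refine not_isLyndon_append_flatten hγ hL (fun δ hδ => ?_) hne h
        rcases List.mem_cons.1 hδ with rfl | hδ
        · exact not_lt.1 hle
        · exact (hs.1 δ hδ).trans (not_lt.1 hle)
      have := ih (hγ.append (hL β (by simp)) hlt) (fun δ hδ => hL δ (by simp [hδ])) hs.2 hL0
        (by simpa using h)
      simpa using this

theorem IsLyndon.exists_isLyndonCut {α : List X} (hα : IsLyndon α) (h : 2 ≤ α.length) :
    ∃ n, IsLyndonCut α n := by
  cases α with
  | nil => simp at h
  | cons x w =>
    obtain ⟨L, h1, h2, rfl⟩ := exists_isLyndonFactorization w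
    refine exists_isLyndonCut_append_flatten (γ := [x]) (isLyndon_singleton x) h1 h2 ?_ hα
    rintro rfl
    simp at h

end WordOrder

/-! ### Brackets along the standard factorization. -/

section Elements

variable {X : Type*} [LinearOrder X] (R : Type*) [CommRing R]

theorem lsE_singleton (x : X) : lsE R [x] = FreeAlgebra.ι R x := by
  rw [lsE, dif_neg]
  rintro ⟨n, h0, h1, -⟩
  simp at h1
  omega

open Classical in
theorem lsE_of_exists_isLyndonCut {α : List X} (hc : ∃ n, IsLyndonCut α n) :
    lsE R α = lsE R (α.take (Nat.find hc)) * lsE R (α.drop (Nat.find hc))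
      - lsE R (α.drop (Nat.find hc)) * lsE R (α.take (Nat.find hc)) := by
  rw [lsE, dif_pos hc]

theorem IsLyndon.exists_lsE_eq {α : List X} (hα : IsLyndon α) (h : 2 ≤ α.length) :
    ∃ β γ, α = β ++ γ ∧ IsLyndon β ∧ IsLyndon γ ∧
      lsE R α = lsE R β * lsE R γ - lsE R γ * lsE R β := by
  classical
  have hc := hα.exists_isLyndonCut h
  obtain ⟨-, -, h1, h2⟩ := Nat.find_spec hc
  exact ⟨_, _, (List.take_append_drop (Nat.find hc) α).symm, h1, h2,
    lsE_of_exists_isLyndonCut R hc⟩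

/-- If all proper suffixes of `γ` are at least `β`, and `γ < β`, then `(γ, β)` is the standard
factorization of `γβ`. -/
theorem lsE_append {γ β : List X} (hγ : IsLyndon γ) (hβ : IsLyndon β)
    (hs : ∀ u v, u ≠ [] → v ≠ [] → γ = u ++ v → β ≤ v) :
    lsE R (γ ++ β) = lsE R γ * lsE R β - lsE R β * lsE R γ := by
  classical
  have hc : ∃ n, IsLyndonCut (γ ++ β) n := ⟨_, isLyndonCut_append hγ hβ⟩
  have hfind : Nat.find hc = γ.length := by
    rw [Nat.find_eq_iff]
    refine ⟨isLyndonCut_append hγ hβ, fun n hn => ?_⟩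
    rintro ⟨h0, -, -, h⟩
    rw [List.drop_append_of_le_length hn.le] at h
    have hd : γ.drop n ≠ [] := by simpa using hn
    -- A cut inside γ = uv would make vβ Lyndon, so that vβ < β ≤ v ≤ vβ.
    have h1 := hs (γ.take n) (γ.drop n) (by simp [hγ.1]; omega) hd
      (List.take_append_drop n γ).symm
    exact absurd ((h.lt_suffix hd hβ.1).trans_le h1) (not_lt.2 (le_append_word _ _))
  rw [lsE, dif_pos hc]
  have e : ∀ m, m = γ.length →
      lsE R ((γ ++ β).take m) * lsE R ((γ ++ β).drop m)
        - lsE R ((γ ++ β).drop m) * lsE R ((γ ++ β).take m)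
      = lsE R γ * lsE R β - lsE R β * lsE R γ := by
    rintro m rfl
    simp
  apply e
  convert hfind

end Elements

/-! ### Unitriangularity with respect to the basis of words. -/

section Triangular

variable {X : Type*} (R : Type*) [CommRing R]

/-- The word `w` as an element of the free algebra. -/
noncomputable def wordElt (w : List X) : FreeAlgebra R X :=
  (w.map (FreeAlgebra.ι R)).prod

theorem wordElt_append (u v : List X) :
    wordElt R (u ++ v) = wordElt R u * wordElt R v := by
  simp [wordElt]

/-- The words form a basis of the free algebra. -/
noncomputable def wordBasis (X : Type*) : Module.Basis (List X) R (FreeAlgebra R X) :=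
  (FreeAlgebra.basisFreeMonoid R X).reindex FreeMonoid.toList

theorem wordBasis_apply (w : List X) : wordBasis R X w = wordElt R w := by
  simp [wordBasis, FreeAlgebra.basisFreeMonoid, FreeAlgebra.equivMonoidAlgebraFreeMonoid, wordElt]

/-- The span of the rearrangements of `w`. -/
noncomputable def permSpan (w : List X) : Submodule R (FreeAlgebra R X) :=
  Submodule.span R (wordElt R '' {v | v.Perm w})

variable {R}

theorem wordElt_mem_permSpan (w : List X) : wordElt R w ∈ permSpan R w :=
  Submodule.subset_span ⟨w, List.Perm.refl w, rfl⟩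

theorem mul_mem_span_image {S T U : Set (List X)} (h : ∀ u ∈ S, ∀ v ∈ T, u ++ v ∈ U)
    {a b : FreeAlgebra R X} (ha : a ∈ Submodule.span R (wordElt R '' S))
    (hb : b ∈ Submodule.span R (wordElt R '' T)) :
    a * b ∈ Submodule.span R (wordElt R '' U) := by
  have h1 := Submodule.mul_mem_mul ha hb
  rw [Submodule.span_mul_span] at h1
  refine Submodule.span_mono ?_ h1
  rintro _ ⟨_, ⟨u, hu, rfl⟩, _, ⟨v, hv, rfl⟩, rfl⟩
  exact ⟨u ++ v, h u hu v hv, wordElt_append R u v⟩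

variable [LinearOrder X]

variable (R) in
/-- The span of the rearrangements of `w` which are larger than `w`. -/
noncomputable def gtSpan (w : List X) : Submodule R (FreeAlgebra R X) :=
  Submodule.span R (wordElt R '' {v | v.Perm w ∧ w < v})

theorem gtSpan_le_permSpan (w : List X) : gtSpan R w ≤ permSpan R w :=
  Submodule.span_mono (Set.image_mono fun _ h => h.1)

theorem mem_permSpan_of_sub_mem {a : FreeAlgebra R X} {w : List X}
    (h : a - wordElt R w ∈ gtSpan R w) : a ∈ permSpan R w := by
  have := (permSpan R w).add_mem (gtSpan_le_permSpan w h) (wordElt_mem_permSpan w)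
  simpa using this

/-- Rearrangements have equal length, so a strict inequality between left factors survives any
continuation to the right. -/
theorem mul_sub_mem_gtSpan {a b : FreeAlgebra R X} {u v : List X}
    (ha : a - wordElt R u ∈ gtSpan R u) (hb : b - wordElt R v ∈ gtSpan R v) :
    a * b - wordElt R (u ++ v) ∈ gtSpan R (u ++ v) := by
  have e : a * b - wordElt R (u ++ v) =
      (a - wordElt R u) * b + wordElt R u * (b - wordElt R v) := by
    rw [wordElt_append]
    noncomm_ring
  rw [e]
  refine Submodule.add_mem _ ?_ ?_
  · refine mul_mem_span_image ?_ ha (mem_permSpan_of_sub_mem hb)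
    rintro u' ⟨hu, hlt⟩ v' hv
    exact ⟨hu.append hv, append_lt_append_of_length_le hlt hu.length_eq.le _ _⟩
  · refine mul_mem_span_image (S := {u}) ?_ (Submodule.subset_span ⟨u, rfl, rfl⟩) hb
    rintro u' hu v' ⟨hv, hlt⟩
    obtain rfl : u' = u := hu
    exact ⟨hv.append_left _, (append_lt_append_left_iff _).2 hlt⟩

/-- In [E_β, E_γ] the second product only involves words from γβ upwards, and γβ > βγ because βγ is
Lyndon. -/
theorem IsLyndon.lsE_sub_mem_gtSpan {α : List X} (hα : IsLyndon α) :
    lsE R α - wordElt R α ∈ gtSpan R α := by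
  induction hn : α.length using Nat.strong_induction_on generalizing α with
  | _ n ih =>
    rcases lt_or_ge α.length 2 with h | h
    · cases α with
      | nil => exact absurd rfl hα.1
      | cons x w =>
        have hw : w = [] := by
          rw [← List.length_eq_zero_iff]
          simp only [List.length_cons] at h
          omega
        subst hw
        simp [lsE_singleton, wordElt]
    · obtain ⟨β, γ, rfl, hβ, hγ, e⟩ := hα.exists_lsE_eq R h
      rw [List.length_append] at hn
      have h1 := List.length_pos_iff.2 hβ.1
      have h2 := List.length_pos_iff.2 hγ.1
      have hb := ih β.length (by omega) hβ rfl
      have hg := ih γ.length (by omega) hγ rfl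
      have hlt : β ++ γ < γ ++ β := hα.2 β γ hβ.1 hγ.1 rfl
      have hle : gtSpan R (γ ++ β) ≤ gtSpan R (β ++ γ) := by
        refine Submodule.span_mono (Set.image_mono ?_)
        rintro v ⟨hv, hvlt⟩
        exact ⟨hv.trans List.perm_append_comm, hlt.trans hvlt⟩
      have e2 : lsE R (β ++ γ) - wordElt R (β ++ γ) =
          (lsE R β * lsE R γ - wordElt R (β ++ γ)) -
            ((lsE R γ * lsE R β - wordElt R (γ ++ β)) + wordElt R (γ ++ β)) := by
        rw [e]
        abel
      rw [e2]
      refine Submodule.sub_mem _ (mul_sub_mem_gtSpan hb hg)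
        (Submodule.add_mem _ (hle (mul_sub_mem_gtSpan hg hb)) ?_)
      exact Submodule.subset_span ⟨_, ⟨List.perm_append_comm, hlt⟩, rfl⟩

theorem prod_lsE_sub_mem_gtSpan {L : List (List X)} (hL : ∀ β ∈ L, IsLyndon β) :
    (L.map (lsE R)).prod - wordElt R L.flatten ∈ gtSpan R L.flatten := by
  induction L with
  | nil => simp [wordElt]
  | cons β L ih =>
    exact mul_sub_mem_gtSpan (hL β (by simp)).lsE_sub_mem_gtSpan
      (ih fun δ hδ => hL δ (by simp [hδ]))

/-- A word has finitely many rearrangements, so a counterexample could be chosen maximal. Keeping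
the span inside one rearrangement class makes the expansion respect letter content. -/
theorem wordElt_mem_span_of_triangular {m : List X → FreeAlgebra R X}
    (hm : ∀ w, m w - wordElt R w ∈ gtSpan R w) (w : List X) :
    wordElt R w ∈ Submodule.span R (m '' {v | v.Perm w}) := by
  have hfin : {v : List X | v.Perm w}.Finite := by
    refine (List.finite_toSet w.permutations).subset fun v hv => ?_
    exact List.mem_permutations.2 hv
  suffices ∀ u, u.Perm w → wordElt R u ∈ Submodule.span R (m '' {v | v.Perm w}) from
    this w (List.Perm.refl w)
  by_contra! hne
  have hfin' : {u : List X | u.Perm w ∧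
      wordElt R u ∉ Submodule.span R (m '' {v | v.Perm w})}.Finite :=
    hfin.subset fun _ h => h.1
  obtain ⟨u, ⟨hu, hun⟩, hmax⟩ := hfin'.exists_maximal hne
  apply hun
  have h1 : m u ∈ Submodule.span R (m '' {v | v.Perm w}) := Submodule.subset_span ⟨u, hu, rfl⟩
  have h2 : gtSpan R u ≤ Submodule.span R (m '' {v | v.Perm w}) := by
    refine Submodule.span_le.2 ?_
    rintro _ ⟨v, ⟨hv, hlt⟩, rfl⟩
    by_contra hvn
    exact absurd (hmax ⟨hv.trans hu, hvn⟩ hlt.le) (not_le.2 hlt)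
  have := Submodule.sub_mem _ h1 (h2 (hm u))
  simpa using this

theorem wordBasis_repr_eq_zero {w : List X} {a : FreeAlgebra R X} (ha : a ∈ gtSpan R w)
    {v : List X} (hv : v ≤ w) : (wordBasis R X).repr a v = 0 := by
  have : gtSpan R w ≤ LinearMap.ker ((wordBasis R X).coord v) := by
    refine Submodule.span_le.2 ?_
    rintro _ ⟨u, ⟨-, hlt⟩, rfl⟩
    have hne : u ≠ v := fun e => absurd (hv.trans_lt hlt) (by simp [e])
    simp [← wordBasis_apply, hne]
  exact this ha

/-- In a relation, the least word of the support occurs only in its own element, with coefficient 1.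
-/
theorem linearIndependent_of_triangular {m : List X → FreeAlgebra R X}
    (hm : ∀ w, m w - wordElt R w ∈ gtSpan R w) : LinearIndependent R m := by
  rw [linearIndependent_iff]
  intro l hl
  by_contra hne
  have hs : l.support.Nonempty := Finsupp.support_nonempty_iff.2 hne
  set w := l.support.min' hs with hw
  have hmem : w ∈ l.support := Finset.min'_mem _ _
  have hrepr : ∀ v ∈ l.support, (wordBasis R X).repr (m v) w = if v = w then 1 else 0 := by
    intro v hv
    have hle : w ≤ v := Finset.min'_le _ _ hv
    have h1 := wordBasis_repr_eq_zero (hm v) hle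
    rw [map_sub, Finsupp.sub_apply, sub_eq_zero] at h1
    rw [h1, ← wordBasis_apply, Module.Basis.repr_self, Finsupp.single_apply]
  have h0 := congrArg (fun a => (wordBasis R X).repr a w) hl
  simp only [Finsupp.linearCombination_apply, Finsupp.sum, map_sum, map_smul, map_zero,
    Finsupp.finsetSum_apply, Finsupp.smul_apply, Finsupp.coe_zero, Pi.zero_apply] at h0
  rw [Finset.sum_congr rfl fun v hv => by rw [hrepr v hv]] at h0
  simp only [smul_eq_mul, mul_ite, mul_one, mul_zero, Finset.sum_ite_eq', hmem, if_true] at h0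
  exact (Finsupp.mem_support_iff.1 hmem) h0

theorem top_le_span_of_triangular {m : List X → FreeAlgebra R X}
    (hm : ∀ w, m w - wordElt R w ∈ gtSpan R w) : ⊤ ≤ Submodule.span R (Set.range m) := by
  rw [← (wordBasis R X).span_eq]
  refine Submodule.span_le.2 ?_
  rintro _ ⟨w, rfl⟩
  rw [wordBasis_apply]
  exact Submodule.span_mono (Set.image_subset_range _ _) (wordElt_mem_span_of_triangular hm w)

end Triangular

/-! ### The basis indexed by multisets of Lyndon words. -/

section Multisets

theorem sort_coe_of_pairwise {α : Type*} [LinearOrder α] {L : List α} (h : L.Pairwise (· ≥ ·)) :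
    (L : Multiset α).sort (· ≥ ·) = L :=
  (Multiset.coe_sort _ _).trans (List.mergeSort_eq_self _ h)

/-- The concatenation of a list of Lyndon words. -/
def listWord (L : List LyndonWord) : List (Fin 2) :=
  (L.map Subtype.val).flatten

/-- The product of the elements `E_α` of a list of Lyndon words. -/
noncomputable def listElt (R : Type*) [CommRing R] (L : List LyndonWord) :
    FreeAlgebra R (Fin 2) :=
  (L.map fun α => lsE R α.1).prod

/-- The non-increasing product of a multiset of Lyndon words. -/
noncomputable def sortedWord (s : Multiset LyndonWord) : List (Fin 2) :=
  listWord (s.sort (· ≥ ·))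

/-- The non-increasing product of the elements `E_α`, with `α` in a multiset of Lyndon words. -/
noncomputable def pbwElt (R : Type*) [CommRing R] (s : Multiset LyndonWord) :
    FreeAlgebra R (Fin 2) :=
  listElt R (s.sort (· ≥ ·))

theorem pbwElt_coe (R : Type*) [CommRing R] {L : List LyndonWord} (h : L.Pairwise (· ≥ ·)) :
    pbwElt R (L : Multiset LyndonWord) = listElt R L := by
  rw [pbwElt, sort_coe_of_pairwise h]

theorem isLyndonFactorization_listWord {L : List LyndonWord} (h : L.Pairwise (· ≥ ·)) :
    IsLyndonFactorization (listWord L) (L.map Subtype.val) := by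
  refine ⟨?_, ?_, rfl⟩
  · intro β hβ
    obtain ⟨γ, -, rfl⟩ := List.mem_map.1 hβ
    exact γ.2
  · rw [List.pairwise_map]
    exact h

/-- The Lyndon factors of a word, as elements of `LyndonWord`. -/
noncomputable def lyndonFactorList (w : List (Fin 2)) : List LyndonWord :=
  (lyndonFactors w).attach.map fun β => ⟨β.1, (lyndonFactors_spec w).1 β.1 β.2⟩

theorem map_val_lyndonFactorList (w : List (Fin 2)) :
    (lyndonFactorList w).map Subtype.val = lyndonFactors w := by
  simp [lyndonFactorList]

theorem pairwise_lyndonFactorList (w : List (Fin 2)) :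
    (lyndonFactorList w).Pairwise (· ≥ ·) := by
  have h := (lyndonFactors_spec w).2.1
  rw [← map_val_lyndonFactorList, List.pairwise_map] at h
  exact h

theorem listWord_lyndonFactorList (w : List (Fin 2)) : listWord (lyndonFactorList w) = w := by
  rw [listWord, map_val_lyndonFactorList]
  exact (lyndonFactors_spec w).2.2

/-- Words correspond to multisets of Lyndon words (Chen, Fox and Lyndon). -/
noncomputable def wordEquiv : List (Fin 2) ≃ Multiset LyndonWord where
  toFun w := lyndonFactorList w
  invFun := sortedWord
  left_inv w := by
    rw [sortedWord, sort_coe_of_pairwise (pairwise_lyndonFactorList w), listWord_lyndonFactorList]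
  right_inv s := by
    have h1 := Multiset.pairwise_sort s (· ≥ ·)
    have h2 : lyndonFactorList (sortedWord s) = s.sort (· ≥ ·) := by
      apply Subtype.val_injective.list_map
      rw [map_val_lyndonFactorList]
      exact (isLyndonFactorization_listWord h1).eq_lyndonFactors.symm
    exact (congrArg _ h2).trans (Multiset.sort_eq s _)

theorem wordEquiv_apply (w : List (Fin 2)) : wordEquiv w = lyndonFactorList w := rfl

theorem wordEquiv_symm_apply (s : Multiset LyndonWord) : wordEquiv.symm s = sortedWord s := rfl

variable (R : Type*) [CommRing R]

theorem pbwElt_wordEquiv_sub_mem (w : List (Fin 2)) :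
    pbwElt R (wordEquiv w) - wordElt R w ∈ gtSpan R w := by
  have h := prod_lsE_sub_mem_gtSpan (R := R) (L := (lyndonFactorList w).map Subtype.val)
    fun β hβ => by
      rw [map_val_lyndonFactorList] at hβ
      exact (lyndonFactors_spec w).1 β hβ
  have e : ((lyndonFactorList w).map Subtype.val).flatten = w := listWord_lyndonFactorList w
  rw [e, List.map_map] at h
  rw [wordEquiv_apply, pbwElt_coe R (pairwise_lyndonFactorList w)]
  exact h

/-- The basis of the free algebra formed by the non-increasing products of the `E_α`. -/
noncomputable def pbwBasis : Module.Basis (Multiset LyndonWord) R (FreeAlgebra R (Fin 2)) :=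
  (Module.Basis.mk (linearIndependent_of_triangular (pbwElt_wordEquiv_sub_mem R))
    (top_le_span_of_triangular (pbwElt_wordEquiv_sub_mem R))).reindex wordEquiv

theorem pbwBasis_apply (s : Multiset LyndonWord) : pbwBasis R s = pbwElt R s := by
  simp [pbwBasis]

theorem sortedWord_perm_of_repr_ne_zero {w : List (Fin 2)} {s : Multiset LyndonWord}
    (h : (pbwBasis R).repr (wordElt R w) s ≠ 0) : (sortedWord s).Perm w := by
  by_contra hp
  apply h
  have h1 := wordElt_mem_span_of_triangular (pbwElt_wordEquiv_sub_mem R) w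
  have h2 : Submodule.span R ((fun v => pbwElt R (wordEquiv v)) '' {v | v.Perm w}) ≤
      LinearMap.ker ((pbwBasis R).coord s) := by
    refine Submodule.span_le.2 ?_
    rintro _ ⟨v, hv, rfl⟩
    have hne : wordEquiv v ≠ s := by
      rintro rfl
      apply hp
      rw [← wordEquiv_symm_apply, Equiv.symm_apply_apply]
      exact hv
    simp [← pbwBasis_apply, hne]
  exact h2 h1

end Multisets

/-! ### Multiplying a monomial by a letter, modulo products of at least two factors. -/

section Straightening

variable (R : Type*) [CommRing R]

/-- The span of the non-increasing products of at least two elements `E_α`, `α ≤ b`. -/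
noncomputable def highSpan (b : LyndonWord) : Submodule R (FreeAlgebra R (Fin 2)) :=
  Submodule.span R (listElt R ''
    {L | L.Pairwise (· ≥ ·) ∧ 2 ≤ L.length ∧ ∀ β ∈ L, β ≤ b})

theorem lsE_mul_mem_highSpan {b β : LyndonWord} (hβ : β ≤ b) {a : FreeAlgebra R (Fin 2)}
    (ha : a ∈ highSpan R β) : lsE R β.1 * a ∈ highSpan R b := by
  have : highSpan R β ≤ (highSpan R b).comap (LinearMap.mulLeft R (lsE R β.1)) := by
    refine Submodule.span_le.2 ?_
    rintro _ ⟨L, ⟨h1, h2, h3⟩, rfl⟩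
    refine Submodule.subset_span ⟨β :: L, ⟨?_, by simp; omega, ?_⟩, by simp [listElt]⟩
    · exact List.pairwise_cons.2 ⟨h3, h1⟩
    · intro δ hδ
      rcases List.mem_cons.1 hδ with rfl | hδ
      · exact hβ
      · exact (h3 δ hδ).trans hβ
  exact this ha

open Classical in
/-- The product `E_γ E_{β₁} ⋯ E_{βₘ}` with `β₁ ≥ ⋯ ≥ βₘ`, where all proper suffixes of `γ` are at
least `β₁`, is `E_{γ β₁ ⋯ βₘ}` (or zero if this word is not Lyndon) up to a combination of
non-increasing products of at least two factors. -/
theorem listElt_cons_sub_mem_highSpan {γ b : LyndonWord} {L : List LyndonWord}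
    (hL : L.Pairwise (· ≥ ·))
    (hs : ∀ β ∈ L, ∀ u v, u ≠ [] → v ≠ [] → γ.1 = u ++ v → β.1 ≤ v)
    (hγb : γ ≤ b) (hLb : ∀ β ∈ L, β ≤ b) :
    listElt R (γ :: L) - (if IsLyndon (γ.1 ++ listWord L) then lsE R (γ.1 ++ listWord L) else 0)
      ∈ highSpan R b := by
  induction L generalizing γ b with
  | nil => simp [listElt, listWord, γ.2]
  | cons β L ih =>
    have hL' := List.pairwise_cons.1 hL
    have hsub : ∀ δ ∈ (β :: L).map Subtype.val, IsLyndon δ := by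
      intro δ hδ
      obtain ⟨ε, -, rfl⟩ := List.mem_map.1 hδ
      exact ε.2
    rcases le_or_gt β γ with h | h
    -- For β ≤ γ the list is already non-increasing, and its word is not Lyndon.
    · rw [if_neg, sub_zero]
      · refine Submodule.subset_span ⟨γ :: β :: L, ⟨?_, by simp, ?_⟩, rfl⟩
        · refine List.pairwise_cons.2 ⟨fun δ hδ => ?_, hL⟩
          rcases List.mem_cons.1 hδ with rfl | hδ
          · exact h
          · exact (hL'.1 δ hδ).trans h
        · intro δ hδ
          rcases List.mem_cons.1 hδ with rfl | hδ
          · exact hγb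
          · exact hLb δ hδ
      · refine not_isLyndon_append_flatten γ.2 hsub (fun δ hδ => ?_) (by simp)
        obtain ⟨ε, hε, rfl⟩ := List.mem_map.1 hδ
        rcases List.mem_cons.1 hε with rfl | hε
        · exact h
        · exact (hL'.1 ε hε).trans h
    · have hprod : IsLyndon (γ.1 ++ β.1) := γ.2.append β.2 h
      have hbr := lsE_append R γ.2 β.2 (hs β (by simp))
      have hlt : γ.1 ++ β.1 < β.1 := hprod.lt_suffix γ.2.1 β.2.1
      have h1 := ih (γ := ⟨γ.1 ++ β.1, hprod⟩) (b := b) hL'.2 ?_ ?_ fun δ hδ => hLb δ (by simp [hδ])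
      rotate_left
      -- The suffix condition passes to γβ: a proper suffix is either a suffix of β, hence at least
      -- β ≥ δ, or begins with a proper suffix of γ, hence is at least δ.
      · intro δ hδ u v hu hv e
        have hδβ : δ.1 ≤ β.1 := hL'.1 δ hδ
        rcases List.append_eq_append_iff.1 e with ⟨t, rfl, e2⟩ | ⟨t, e1, rfl⟩
        · rcases eq_or_ne t [] with rfl | ht
          · rw [List.nil_append] at e2
            rwa [← e2]
          · have := β.2
            rw [e2] at this hδβ
            exact hδβ.trans (this.lt_suffix ht hv).le
        · rcases eq_or_ne t [] with rfl | ht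
          · simpa using hδβ
          · exact (hs δ (by simp [hδ]) u t hu ht e1).trans (le_append_word _ _)
      · exact le_trans (show (⟨γ.1 ++ β.1, hprod⟩ : LyndonWord) ≤ β from hlt.le) (hLb β (by simp))
      -- The bound is β here, rather than `b`, so that E_β can be put in front and the products stay
      -- non-increasing.
      have h2 := ih (γ := γ) (b := β) hL'.2 (fun δ hδ => hs δ (by simp [hδ])) h.le hL'.1
      have hβb := hLb β (by simp)
      have h3 := lsE_mul_mem_highSpan R hβb h2
      have h4 : lsE R β.1 *
          (if IsLyndon (γ.1 ++ listWord L) then lsE R (γ.1 ++ listWord L) else 0)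
            ∈ highSpan R b := by
        split_ifs with hly
        · have hle : γ.1 ++ listWord L ≤ β.1 := by
            refine hly.append_flatten_le γ.2.1 (fun δ hδ => hsub δ (by simp at hδ ⊢; tauto))
              h.le fun δ hδ => ?_
            obtain ⟨ε, hε, rfl⟩ := List.mem_map.1 hδ
            exact hL'.1 ε hε
          refine Submodule.subset_span ⟨[β, ⟨_, hly⟩], ⟨?_, by simp, ?_⟩, by simp [listElt]⟩
          · exact List.pairwise_pair.2 hle
          · intro δ hδ
            simp only [List.mem_cons, List.not_mem_nil, or_false] at hδ
            rcases hδ with rfl | rfl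
            · exact hβb
            · exact le_trans (show (⟨_, hly⟩ : LyndonWord) ≤ β from hle) hβb
        · simp
      have hw : γ.1 ++ listWord (β :: L) = (γ.1 ++ β.1) ++ listWord L := by simp [listWord]
      -- E_γ E_β = E_{γβ} + E_β E_γ, since (γ, β) is the standard factorization of γβ.
      have key : listElt R (γ :: β :: L) =
          listElt R (⟨γ.1 ++ β.1, hprod⟩ :: L) + lsE R β.1 * listElt R (γ :: L) := by
        simp only [listElt, List.map_cons, List.prod_cons, hbr]
        noncomm_ring
      rw [hw, key]
      have := Submodule.add_mem _ h1 (Submodule.add_mem _ h3 h4)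
      rw [mul_sub, sub_add_cancel] at this
      convert this using 1
      abel

theorem repr_singleton_eq_zero_of_mem_highSpan {b : LyndonWord} {a : FreeAlgebra R (Fin 2)}
    (ha : a ∈ highSpan R b) (α : LyndonWord) : (pbwBasis R).repr a {α} = 0 := by
  have : highSpan R b ≤ LinearMap.ker ((pbwBasis R).coord {α}) := by
    refine Submodule.span_le.2 ?_
    rintro _ ⟨L, ⟨h1, h2, -⟩, rfl⟩
    have hne : (L : Multiset LyndonWord) ≠ {α} := by
      intro e
      have := congrArg Multiset.card e
      simp at this
      omega
    simp [← pbwElt_coe R h1, ← pbwBasis_apply, hne]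
  exact this ha

theorem lsE_eq_pbwElt (α : LyndonWord) : lsE R α.1 = pbwElt R {α} := by
  simp [pbwElt, listElt]

theorem lsE_eq_pbwBasis (α : LyndonWord) : lsE R α.1 = pbwBasis R {α} := by
  rw [pbwBasis_apply, lsE_eq_pbwElt]

open Classical in
-- A letter has no proper nonempty suffix, so the straightening applies to it with every `s`. The
-- bound `b` is irrelevant for coefficients at single elements.
theorem repr_ι_mul_pbwElt (y : Fin 2) (s : Multiset LyndonWord) (α : LyndonWord) :
    (pbwBasis R).repr (FreeAlgebra.ι R y * pbwElt R s) {α} =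
      if y :: sortedWord s = α.1 then 1 else 0 := by
  set L := s.sort (· ≥ ·) with hL
  set γ : LyndonWord := ⟨[y], isLyndon_singleton y⟩
  obtain ⟨b, hb⟩ : ∃ b, ∀ β ∈ γ :: L, β ≤ b :=
    ⟨(γ :: L).toFinset.max' ⟨γ, by simp⟩, fun β hβ => Finset.le_max' _ _ (by simpa using hβ)⟩
  have h := listElt_cons_sub_mem_highSpan R (γ := γ) (b := b) (L := L)
    (Multiset.pairwise_sort s (· ≥ ·)) ?_ (hb _ (by simp)) fun β hβ => hb β (by simp [hβ])
  · have h1 := repr_singleton_eq_zero_of_mem_highSpan R h α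
    have e : listElt R (γ :: L) = FreeAlgebra.ι R y * pbwElt R s := by
      simp [listElt, pbwElt, γ, lsE_singleton, hL]
    have e2 : γ.1 ++ listWord L = y :: sortedWord s := rfl
    rw [map_sub, Finsupp.sub_apply, sub_eq_zero, e, e2] at h1
    rw [h1]
    split_ifs with hly hα hα
    · rw [lsE_eq_pbwBasis R ⟨_, hly⟩, Module.Basis.repr_self]
      simp [hα]
    · rw [lsE_eq_pbwBasis R ⟨_, hly⟩, Module.Basis.repr_self, Finsupp.single_apply, if_neg]
      intro e
      exact hα (congrArg Subtype.val (Multiset.singleton_inj.1 e))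
    · rw [hα] at hly
      exact absurd α.2 hly
    · simp
  · intro β _ u v hu hv e
    have h1 := congrArg List.length e
    have h2 := List.length_pos_iff.2 hu
    have h3 := List.length_pos_iff.2 hv
    simp [γ] at h1
    omega

end Straightening

/-! ### The coproduct on the ordered basis. -/

section Coproduct

open scoped TensorProduct

theorem sum_antidiagonal_ite_fst_eq_zero {α M : Type*} [DecidableEq α] [AddCommMonoid M]
    (s : Multiset α) (F : Multiset α → M) :
    (s.antidiagonal.map fun p => if p.1 = 0 then F p.2 else 0).sum = F s := by
  induction s using Multiset.induction generalizing F with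
  | empty => simp
  | cons a s ih =>
    have := ih fun t => F (a ::ₘ t)
    simpa [Multiset.antidiagonal_cons, Function.comp_def] using this

/-- The antidiagonal counts splittings with multiplicity, so a single `x` can be split off in
`s.count x` ways. -/
theorem sum_antidiagonal_ite_fst_eq_singleton {α M : Type*} [DecidableEq α] [AddCommMonoid M]
    (s : Multiset α) (x : α) (F : Multiset α → M) :
    (s.antidiagonal.map fun p => if p.1 = {x} then F p.2 else 0).sum =
      s.count x • F (s.erase x) := by
  induction s using Multiset.induction generalizing F with
  | empty => simp [Multiset.zero_ne_singleton]
  | cons a s ih =>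
    have h1 := ih fun t => F (a ::ₘ t)
    simp only [Multiset.antidiagonal_cons, Multiset.map_add, Multiset.map_map, Function.comp_def,
      Multiset.sum_add, Prod.map_fst, Prod.map_snd, id, h1]
    by_cases hax : a = x
    · subst hax
      have h2 : ∀ t : Multiset α, a ::ₘ t = {a} ↔ t = 0 := fun t => by
        rw [← Multiset.cons_zero, Multiset.cons_inj_right]
      simp only [h2, sum_antidiagonal_ite_fst_eq_zero, Multiset.count_cons_self,
        Multiset.erase_cons_head, succ_nsmul]
      congr 1
      by_cases hc : a ∈ s
      · rw [Multiset.cons_erase hc]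
      · simp [Multiset.count_eq_zero_of_notMem hc]
    · have h2 : ∀ t : Multiset α, a ::ₘ t ≠ {x} := fun t e => by
        have : a ∈ ({x} : Multiset α) := e ▸ Multiset.mem_cons_self a t
        exact hax (Multiset.mem_singleton.1 this)
      simp [h2, Multiset.count_cons_of_ne (Ne.symm hax), Multiset.erase_cons_tail s hax]

variable (R : Type*) [CommRing R]

/-- The coproduct of the free algebra for which the letters are primitive. -/
noncomputable def coproduct :
    FreeAlgebra R (Fin 2) →ₐ[R] FreeAlgebra R (Fin 2) ⊗[R] FreeAlgebra R (Fin 2) :=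
  FreeAlgebra.lift R fun x => FreeAlgebra.ι R x ⊗ₜ 1 + 1 ⊗ₜ FreeAlgebra.ι R x

theorem coproduct_ι (x : Fin 2) :
    coproduct R (FreeAlgebra.ι R x) = FreeAlgebra.ι R x ⊗ₜ 1 + 1 ⊗ₜ FreeAlgebra.ι R x := by
  simp [coproduct]

/-- A commutator of primitive elements is primitive. -/
theorem coproduct_lsE {α : List (Fin 2)} (hα : IsLyndon α) :
    coproduct R (lsE R α) = lsE R α ⊗ₜ 1 + 1 ⊗ₜ lsE R α := by
  induction hn : α.length using Nat.strong_induction_on generalizing α with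
  | _ n ih =>
    rcases lt_or_ge α.length 2 with h | h
    · cases α with
      | nil => exact absurd rfl hα.1
      | cons x w =>
        have hw : w = [] := by
          rw [← List.length_eq_zero_iff]
          simp only [List.length_cons] at h
          omega
        subst hw
        rw [lsE_singleton, coproduct_ι]
    · obtain ⟨β, γ, rfl, hβ, hγ, e⟩ := hα.exists_lsE_eq R h
      rw [List.length_append] at hn
      have h1 := List.length_pos_iff.2 hβ.1
      have h2 := List.length_pos_iff.2 hγ.1
      rw [e, map_sub, map_mul, map_mul, ih β.length (by omega) hβ rfl,
        ih γ.length (by omega) hγ rfl]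
      simp only [mul_add, add_mul, Algebra.TensorProduct.tmul_mul_tmul, one_mul, mul_one,
        TensorProduct.sub_tmul, TensorProduct.tmul_sub]
      abel

theorem listElt_cons (α : LyndonWord) (L : List LyndonWord) :
    listElt R (α :: L) = lsE R α.1 * listElt R L := by
  simp [listElt]

theorem pbwElt_cons {a : LyndonWord} {s : Multiset LyndonWord} (h : ∀ β ∈ s, β ≤ a) :
    pbwElt R (a ::ₘ s) = lsE R a.1 * pbwElt R s := by
  have h1 : (a :: s.sort (· ≥ ·)).Pairwise (· ≥ ·) :=
    List.pairwise_cons.2 ⟨fun β hβ => h β (by simpa using hβ), Multiset.pairwise_sort s (· ≥ ·)⟩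
  have h2 := pbwElt_coe R h1
  rw [← Multiset.cons_coe, Multiset.sort_eq, listElt_cons] at h2
  exact h2

/-- Each primitive factor goes to the left or to the right; both subproducts remain non-increasing,
so no straightening is needed. -/
theorem coproduct_listElt {L : List LyndonWord} (hL : L.Pairwise (· ≥ ·)) :
    coproduct R (listElt R L) =
      ((L : Multiset LyndonWord).antidiagonal.map fun p => pbwElt R p.1 ⊗ₜ[R] pbwElt R p.2).sum := by
  induction L with
  | nil => simp [listElt, pbwElt, Algebra.TensorProduct.one_def]
  | cons a L ih =>
    have hL' := List.pairwise_cons.1 hL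
    rw [listElt_cons, map_mul, coproduct_lsE R a.2, ih hL'.2, ← Multiset.cons_coe,
      Multiset.antidiagonal_cons, Multiset.map_add, Multiset.sum_add, Multiset.map_map,
      Multiset.map_map, add_mul, ← Multiset.sum_map_mul_left, ← Multiset.sum_map_mul_left, add_comm]
    have hle : ∀ p ∈ (L : Multiset LyndonWord).antidiagonal,
        (∀ β ∈ p.1, β ≤ a) ∧ ∀ β ∈ p.2, β ≤ a := by
      intro p hp
      have hp' := Multiset.mem_antidiagonal.1 hp
      have hmem : ∀ β ∈ p.1 + p.2, β ≤ a := by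
        rw [hp']
        exact fun β hβ => hL'.1 β (by simpa using hβ)
      exact ⟨fun β hβ => hmem β (by simp [hβ]), fun β hβ => hmem β (by simp [hβ])⟩
    congr 2
    · refine Multiset.map_congr rfl fun p hp => ?_
      simp [pbwElt_cons R (hle p hp).2]
    · refine Multiset.map_congr rfl fun p hp => ?_
      simp [pbwElt_cons R (hle p hp).1]

theorem coproduct_pbwElt (s : Multiset LyndonWord) :
    coproduct R (pbwElt R s) =
      (s.antidiagonal.map fun p => pbwElt R p.1 ⊗ₜ[R] pbwElt R p.2).sum := by
  rw [pbwElt, coproduct_listElt R (Multiset.pairwise_sort s (· ≥ ·)), Multiset.sort_eq]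

theorem coord_tensor_coproduct (α : LyndonWord) (s : Multiset LyndonWord)
    (a : FreeAlgebra R (Fin 2)) :
    ((pbwBasis R).tensorProduct (pbwBasis R)).repr (coproduct R a) ({α}, s) =
      (α ::ₘ s).count α • (pbwBasis R).repr a (α ::ₘ s) := by
  classical
  suffices (((pbwBasis R).tensorProduct (pbwBasis R)).coord ({α}, s)).comp
      (coproduct R).toLinearMap = (α ::ₘ s).count α • (pbwBasis R).coord (α ::ₘ s) from
    LinearMap.congr_fun this a
  refine (pbwBasis R).ext fun u => ?_
  have h := sum_antidiagonal_ite_fst_eq_singleton u α fun t => if t = s then (1 : R) else 0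
  have h1 : (((pbwBasis R).tensorProduct (pbwBasis R)).coord ({α}, s)).comp
      (coproduct R).toLinearMap (pbwBasis R u) =
      (u.antidiagonal.map fun p => if p.1 = {α} then if p.2 = s then (1 : R) else 0 else 0).sum := by
    rw [LinearMap.comp_apply, pbwBasis_apply, AlgHom.toLinearMap_apply, coproduct_pbwElt,
      map_multiset_sum, Multiset.map_map]
    congr 1
    refine Multiset.map_congr rfl fun p _ => ?_
    rw [Function.comp_apply, Module.Basis.coord_apply, Module.Basis.tensorProduct_repr_tmul_apply,
      ← pbwBasis_apply, ← pbwBasis_apply, Module.Basis.repr_self, Module.Basis.repr_self,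
      Finsupp.single_apply, Finsupp.single_apply]
    split_ifs <;> simp
  rw [h1, h, LinearMap.smul_apply, Module.Basis.coord_apply, Module.Basis.repr_self,
    Finsupp.single_apply]
  by_cases hu : u = α ::ₘ s
  · subst hu
    simp
  · rw [if_neg hu, smul_zero]
    by_cases hα : α ∈ u
    · rw [if_neg, smul_zero]
      rintro rfl
      exact hu (Multiset.cons_erase hα).symm
    · rw [Multiset.count_eq_zero_of_notMem hα, zero_smul]

end Coproduct

/-! ### Two relations for the coefficients of powers of the letter sum. -/

section Powers

variable (R : Type*) [CommRing R]

/-- The sum of the two letters. -/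
noncomputable def letterSum : FreeAlgebra R (Fin 2) :=
  FreeAlgebra.ι R 0 + FreeAlgebra.ι R 1

theorem letterSum_pow (d : ℕ) :
    letterSum R ^ d = ∑ w : Fin d → Fin 2, wordElt R (List.ofFn w) := by
  induction d with
  | zero => simp [wordElt]
  | succ d ih =>
    rw [pow_succ', ih, ← (Fin.consEquiv fun _ : Fin (d + 1) => Fin 2).sum_comp,
      Fintype.sum_prod_type, Fin.sum_univ_two, letterSum, add_mul, Finset.mul_sum, Finset.mul_sum]
    simp [wordElt, List.ofFn_succ, Fin.consEquiv]

theorem length_sortedWord (s : Multiset LyndonWord) :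
    (sortedWord s).length = (s.map fun α => α.1.length).sum := by
  conv_rhs => rw [← Multiset.sort_eq s (· ≥ ·)]
  rw [sortedWord, listWord, List.length_flatten, List.map_map, Multiset.map_coe,
    Multiset.sum_coe]
  rfl

theorem count_sortedWord (x : Fin 2) (s : Multiset LyndonWord) :
    (sortedWord s).count x = (s.map fun α => α.1.count x).sum := by
  conv_rhs => rw [← Multiset.sort_eq s (· ≥ ·)]
  rw [sortedWord, listWord, List.count_flatten, List.map_map, Multiset.map_coe,
    Multiset.sum_coe]
  rfl

theorem length_sortedWord_of_repr_ne_zero {d : ℕ} {s : Multiset LyndonWord}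
    (h : (pbwBasis R).repr (letterSum R ^ d) s ≠ 0) : (sortedWord s).length = d := by
  rw [letterSum_pow, map_sum, Finsupp.finsetSum_apply] at h
  obtain ⟨w, -, hw⟩ := Finset.exists_ne_zero_of_sum_ne_zero h
  simpa using (sortedWord_perm_of_repr_ne_zero R hw).length_eq

/-- The coefficient of the element of the basis with index `s` in the power of the sum of the
letters to which it contributes. -/
noncomputable def powCoeff (s : Multiset LyndonWord) : ℤ :=
  (pbwBasis ℤ).repr (letterSum ℤ ^ (sortedWord s).length) s

theorem powCoeff_zero : powCoeff 0 = 1 := by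
  have h : (1 : FreeAlgebra ℤ (Fin 2)) = pbwBasis ℤ 0 := by
    simp [pbwBasis_apply, pbwElt, listElt]
  rw [powCoeff, length_sortedWord, Multiset.map_zero, Multiset.sum_zero, pow_zero, h]
  simp

theorem powCoeff_singleton_cons {x : Fin 2} {w : List (Fin 2)} (h : IsLyndon (x :: w)) :
    powCoeff {⟨x :: w, h⟩} = powCoeff (wordEquiv w) := by
  have h1 : sortedWord {⟨x :: w, h⟩} = x :: w := by simp [sortedWord, listWord]
  have h2 : sortedWord (wordEquiv w) = w := by
    rw [← wordEquiv_symm_apply, Equiv.symm_apply_apply]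
  rw [powCoeff, powCoeff, h1, h2, List.length_cons, pow_succ']
  -- The equality holds for linear functionals and is checked on the basis: of the two letters only
  -- `x` can complete `w` to the word `x :: w`.
  suffices ((pbwBasis ℤ).coord {⟨x :: w, h⟩}).comp (LinearMap.mulLeft ℤ (letterSum ℤ)) =
      (pbwBasis ℤ).coord (wordEquiv w) from LinearMap.congr_fun this _
  refine (pbwBasis ℤ).ext fun s => ?_
  have hs : s = wordEquiv w ↔ sortedWord s = w := by
    rw [← wordEquiv_symm_apply, Equiv.symm_apply_eq]
  rw [LinearMap.comp_apply, Module.Basis.coord_apply, Module.Basis.coord_apply,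
    Module.Basis.repr_self, pbwBasis_apply, LinearMap.mulLeft_apply, letterSum, add_mul, map_add,
    Finsupp.add_apply, repr_ι_mul_pbwElt, repr_ι_mul_pbwElt, Finsupp.single_apply]
  simp only [hs, List.cons.injEq]
  by_cases hw : sortedWord s = w
  · fin_cases x <;> simp [hw]
  · simp [hw]

open scoped TensorProduct in
theorem coproduct_letterSum_pow (d : ℕ) :
    coproduct R (letterSum R ^ d) = ∑ m ∈ Finset.range (d + 1),
      d.choose m • ((letterSum R ^ m) ⊗ₜ[R] (letterSum R ^ (d - m))) := by
  have h : coproduct R (letterSum R) = letterSum R ⊗ₜ 1 + 1 ⊗ₜ letterSum R := by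
    rw [letterSum, map_add, coproduct_ι, coproduct_ι, TensorProduct.add_tmul,
      TensorProduct.tmul_add]
    abel
  have hc : Commute (letterSum R ⊗ₜ[R] (1 : FreeAlgebra R (Fin 2)))
      ((1 : FreeAlgebra R (Fin 2)) ⊗ₜ[R] letterSum R) := by
    simp [Commute, SemiconjBy]
  rw [map_pow, h, hc.add_pow]
  refine Finset.sum_congr rfl fun m _ => ?_
  rw [Algebra.TensorProduct.tmul_pow, Algebra.TensorProduct.tmul_pow,
    Algebra.TensorProduct.tmul_mul_tmul, one_pow, one_pow, one_mul, mul_one, nsmul_eq_mul,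
    Nat.cast_comm]

theorem length_sortedWord_cons (α : LyndonWord) (s : Multiset LyndonWord) :
    (sortedWord (α ::ₘ s)).length = α.1.length + (sortedWord s).length := by
  simp [length_sortedWord]

theorem sortedWord_singleton (α : LyndonWord) : sortedWord {α} = α.1 := by
  simp [sortedWord, listWord]

/-- Both sides are the coefficient at E_α ⊗ s of the coproduct of the power; by homogeneity only the
binomial term with m = |α| survives. -/
theorem count_mul_powCoeff_cons (α : LyndonWord) (s : Multiset LyndonWord) :
    ((α ::ₘ s).count α : ℤ) * powCoeff (α ::ₘ s) =
      (sortedWord (α ::ₘ s)).length.choose α.1.length * powCoeff {α} * powCoeff s := by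
  have h := coord_tensor_coproduct ℤ α s (letterSum ℤ ^ (sortedWord (α ::ₘ s)).length)
  rw [nsmul_eq_mul] at h
  rw [powCoeff, ← h, coproduct_letterSum_pow, map_sum, Finsupp.finsetSum_apply,
    Finset.sum_eq_single α.1.length]
  · rw [map_nsmul, Finsupp.smul_apply, Module.Basis.tensorProduct_repr_tmul_apply, powCoeff,
      powCoeff, sortedWord_singleton, length_sortedWord_cons, Nat.add_sub_cancel_left]
    simp only [nsmul_eq_mul, smul_eq_mul]
    ring
  · intro m _ hm
    have h0 : (pbwBasis ℤ).repr (letterSum ℤ ^ m) {α} = 0 := by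
      by_contra h0
      apply hm
      rw [← length_sortedWord_of_repr_ne_zero ℤ h0, sortedWord_singleton]
    rw [map_nsmul, Finsupp.smul_apply, Module.Basis.tensorProduct_repr_tmul_apply, h0]
    simp
  · intro hm
    rw [length_sortedWord_cons, Finset.mem_range] at hm
    omega

end Powers

/-! ### The closed formula and the recursion for the constants. -/

section ClosedForm

/-- The product of the factorials of the multiplicities of a multiset. -/
def factorialCount {α : Type*} [DecidableEq α] (s : Multiset α) : ℕ :=
  ∏ a ∈ s.toFinset, (s.count a)!

theorem factorialCount_cons {α : Type*} [DecidableEq α] (a : α) (s : Multiset α) :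
    factorialCount (a ::ₘ s) = (a ::ₘ s).count a * factorialCount s := by
  have ha : a ∈ insert a s.toFinset := Finset.mem_insert_self _ _
  have h1 : factorialCount s = ∏ b ∈ insert a s.toFinset, (s.count b)! := by
    refine Finset.prod_subset (Finset.subset_insert _ _) fun b _ hb => ?_
    rw [Multiset.count_eq_zero_of_notMem (by simpa using hb), Nat.factorial_zero]
  rw [h1, factorialCount, Multiset.toFinset_cons, ← Finset.mul_prod_erase _ _ ha,
    ← Finset.mul_prod_erase _ _ ha, Multiset.count_cons_self, Nat.factorial_succ, mul_assoc]
  congr 2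
  refine Finset.prod_congr rfl fun b hb => ?_
  rw [Multiset.count_cons_of_ne (Finset.ne_of_mem_erase hb)]

/-- Adding one factor at a time, the binomials telescope to a multinomial and the counts to the
factorials of the multiplicities. -/
theorem powCoeff_eq (s : Multiset LyndonWord) :
    (powCoeff s : ℚ) = ((sortedWord s).length ! : ℚ) / (factorialCount s : ℚ) *
      (s.map fun α => (powCoeff {α} : ℚ) / (α.1.length ! : ℚ)).prod := by
  induction s using Multiset.induction with
  | empty => simp [powCoeff_zero, factorialCount, length_sortedWord]
  | cons α s ih =>
    have h := congrArg (Int.cast : ℤ → ℚ) (count_mul_powCoeff_cons α s)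
    push_cast at h
    have hc : ((α ::ₘ s).count α : ℚ) ≠ 0 := by
      rw [Multiset.count_cons_self]
      positivity
    have hf : (factorialCount s : ℚ) ≠ 0 := by
      rw [factorialCount]
      exact_mod_cast (Finset.prod_pos fun a _ => Nat.factorial_pos _).ne'
    rw [ih, length_sortedWord_cons, Nat.cast_add_choose] at h
    rw [Multiset.map_cons, Multiset.prod_cons, factorialCount_cons, length_sortedWord_cons,
      ← mul_right_inj' hc, h]
    have h1 : (α.1.length ! : ℚ) ≠ 0 := by positivity
    have h2 : ((sortedWord s).length ! : ℚ) ≠ 0 := by positivity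
    push_cast
    field_simp

theorem lsConst_cons {X : Type*} [LinearOrder X] [DecidableEq (List X)] (x : X) (w : List X) :
    lsConst (x :: w) = (w.length ! : ℚ) /
        (((lyndonFactors w).map fun β => (β.length ! : ℚ)).prod *
          (factorialCount (lyndonFactors w : Multiset (List X)) : ℚ)) *
      ((lyndonFactors w).map lsConst).prod := by
  rw [lsConst, List.attach_map_val, factorialCount, List.toFinset_coe]
  push_cast
  simp only [Multiset.coe_count]
  congr!

theorem lsConst_nonneg {X : Type*} [LinearOrder X] (α : List X) : 0 ≤ lsConst α := by
  classical
  induction hn : α.length using Nat.strong_induction_on generalizing α with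
  | _ n ih =>
    cases α with
    | nil => simp [lsConst]
    | cons x w =>
      rw [lsConst_cons]
      have h1 : 0 ≤ ((lyndonFactors w).map lsConst).prod := by
        refine List.prod_nonneg fun c hc => ?_
        obtain ⟨β, hβ, rfl⟩ := List.mem_map.1 hc
        have := length_le_of_mem_lyndonFactors hβ
        rw [List.length_cons] at hn
        exact ih β.length (by omega) β rfl
      have h2 : 0 ≤ ((lyndonFactors w).map fun β => (β.length ! : ℚ)).prod := by
        refine List.prod_nonneg fun c hc => ?_
        obtain ⟨β, -, rfl⟩ := List.mem_map.1 hc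
        positivity
      positivity

theorem factorialCount_map {α β : Type*} [DecidableEq α] [DecidableEq β] {f : α → β}
    (hf : Function.Injective f) (s : Multiset α) :
    factorialCount (s.map f) = factorialCount s := by
  induction s using Multiset.induction with
  | empty => simp [factorialCount]
  | cons a s ih =>
    rw [Multiset.map_cons, factorialCount_cons, factorialCount_cons, ih, ← Multiset.map_cons,
      Multiset.count_map_eq_count' f _ hf]

/-- Removing the first letter leaves the coefficient of the factors of the rest, to which the closed
formula and induction on the length apply. -/
theorem powCoeff_singleton (α : LyndonWord) : (powCoeff {α} : ℚ) = lsConst α.1 := by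
  induction hn : α.1.length using Nat.strong_induction_on generalizing α with
  | _ n ih =>
    obtain ⟨α, hα⟩ := α
    cases α with
    | nil => exact absurd rfl hα.1
    | cons x w =>
      have hw : sortedWord (wordEquiv w) = w := by
        rw [← wordEquiv_symm_apply, Equiv.symm_apply_apply]
      have hmap : (wordEquiv w).map Subtype.val = (lyndonFactors w : Multiset (List (Fin 2))) := by
        rw [wordEquiv_apply, Multiset.map_coe, map_val_lyndonFactorList]
      have hih : ((wordEquiv w).map fun α => (powCoeff {α} : ℚ) / (α.1.length ! : ℚ)) =
          (wordEquiv w).map fun α => lsConst α.1 / (α.1.length ! : ℚ) := by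
        refine Multiset.map_congr rfl fun β hβ => ?_
        have hmem : β.1 ∈ lyndonFactors w := by
          rw [← Multiset.mem_coe, ← hmap]
          exact Multiset.mem_map_of_mem _ hβ
        have := length_le_of_mem_lyndonFactors hmem
        rw [List.length_cons] at hn
        rw [ih β.1.length (by omega) β rfl]
      have h1 : ((wordEquiv w).map fun α => lsConst α.1).prod =
          ((lyndonFactors w).map lsConst).prod := by
        rw [← Multiset.prod_coe, ← Multiset.map_coe, ← hmap, Multiset.map_map]
        rfl
      have h2 : ((wordEquiv w).map fun α => (α.1.length ! : ℚ)).prod =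
          ((lyndonFactors w).map fun β => (β.length ! : ℚ)).prod := by
        rw [← Multiset.prod_coe, ← Multiset.map_coe, ← hmap, Multiset.map_map]
        rfl
      rw [powCoeff_singleton_cons, powCoeff_eq, hw, hih, Multiset.prod_map_div, h1, h2,
        lsConst_cons, ← hmap, factorialCount_map Subtype.val_injective]
      rw [div_mul_div_comm, div_mul_eq_mul_div, mul_comm (factorialCount _ : ℚ)]

theorem powCoeff_nonneg (s : Multiset LyndonWord) : 0 ≤ powCoeff s := by
  have h : (0 : ℚ) ≤ powCoeff s := by
    rw [powCoeff_eq]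
    refine mul_nonneg (by positivity) (Multiset.prod_nonneg fun c hc => ?_)
    obtain ⟨α, -, rfl⟩ := Multiset.mem_map.1 hc
    rw [powCoeff_singleton]
    exact div_nonneg (lsConst_nonneg _) (by positivity)
  exact_mod_cast h

end ClosedForm

/-! ### Change of coefficients and fixed letter content. -/

section Expansion

variable (R : Type*) [CommRing R]

/-- The change of coefficients on the free algebra. -/
noncomputable def baseChange : FreeAlgebra ℤ (Fin 2) →ₐ[ℤ] FreeAlgebra R (Fin 2) :=
  FreeAlgebra.lift ℤ (FreeAlgebra.ι R)

theorem baseChange_ι (x : Fin 2) : baseChange R (FreeAlgebra.ι ℤ x) = FreeAlgebra.ι R x := by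
  simp [baseChange]

/-- The standard factorization depends on the word only, not on the ring. -/
theorem baseChange_lsE {α : List (Fin 2)} (hα : IsLyndon α) :
    baseChange R (lsE ℤ α) = lsE R α := by
  induction hn : α.length using Nat.strong_induction_on generalizing α with
  | _ n ih =>
    rcases lt_or_ge α.length 2 with h | h
    · cases α with
      | nil => exact absurd rfl hα.1
      | cons x w =>
        have hw : w = [] := by
          rw [← List.length_eq_zero_iff]
          simp only [List.length_cons] at h
          omega
        subst hw
        rw [lsE_singleton, lsE_singleton, baseChange_ι]
    · classical
      have hc := hα.exists_isLyndonCut h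
      obtain ⟨h0, h1, h2, h3⟩ := Nat.find_spec hc
      rw [lsE_of_exists_isLyndonCut ℤ hc, lsE_of_exists_isLyndonCut R hc, map_sub, map_mul, map_mul,
        ih _ _ h2 rfl, ih _ _ h3 rfl]
      · rw [List.length_drop]
        omega
      · rw [List.length_take]
        omega

theorem baseChange_pbwElt (s : Multiset LyndonWord) :
    baseChange R (pbwElt ℤ s) = pbwElt R s := by
  rw [pbwElt, pbwElt, listElt, listElt, map_list_prod, List.map_map]
  congr 1
  exact List.map_congr_left fun α _ => baseChange_lsE R α.2

theorem lsSH_eq (i j : ℕ) : lsSH R i j =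
    ∑ w : Fin (i + j) → Fin 2 with (List.ofFn w).count 1 = i ∧ (List.ofFn w).count 0 = j,
      wordElt R (List.ofFn w) := by
  rw [lsSH, shufflePoly]
  refine Finset.sum_congr rfl fun w _ => ?_
  rw [wordElt]
  congr 1
  refine List.map_congr_left fun a _ => ?_
  rw [lsE_singleton, lsE_singleton]
  fin_cases a <;> simp

theorem baseChange_lsSH (i j : ℕ) : baseChange R (lsSH ℤ i j) = lsSH R i j := by
  rw [lsSH_eq, lsSH_eq, map_sum]
  refine Finset.sum_congr rfl fun w _ => ?_
  rw [wordElt, wordElt, map_list_prod, List.map_map]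
  congr 1
  exact List.map_congr_left fun a _ => baseChange_ι R a

theorem baseChange_letterSum : baseChange R (letterSum ℤ) = letterSum R := by
  rw [letterSum, letterSum, map_add, baseChange_ι, baseChange_ι]

theorem repr_letterSum_pow (d : ℕ) (s : Multiset LyndonWord) :
    (pbwBasis ℤ).repr (letterSum ℤ ^ d) s =
      if (sortedWord s).length = d then powCoeff s else 0 := by
  split_ifs with h
  · rw [powCoeff, h]
  · by_contra h0
    exact h (length_sortedWord_of_repr_ne_zero ℤ h0)

theorem repr_lsSH (i j : ℕ) (s : Multiset LyndonWord) :
    (pbwBasis ℤ).repr (lsSH ℤ i j) s =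
      if (sortedWord s).count 1 = i ∧ (sortedWord s).count 0 = j then powCoeff s else 0 := by
  have hperm : ∀ (w : Fin (i + j) → Fin 2),
      (pbwBasis ℤ).repr (wordElt ℤ (List.ofFn w)) s ≠ 0 → ∀ x,
        (sortedWord s).count x = (List.ofFn w).count x := fun w hw x =>
    (sortedWord_perm_of_repr_ne_zero ℤ hw).count_eq x
  have hlen : ∀ u : List (Fin 2), u.length = u.count 1 + u.count 0 := by
    intro u
    induction u with
    | nil => rfl
    | cons x u ih => fin_cases x <;> simp [ih] <;> omega
  rw [lsSH_eq, map_sum, Finsupp.finsetSum_apply]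
  split_ifs with h
  · rw [powCoeff, hlen, h.1, h.2, letterSum_pow, map_sum, Finsupp.finsetSum_apply]
    -- In the full power, a word contributing to `s` is a rearrangement of `sortedWord s`, so it
    -- already satisfies the filter.
    refine Finset.sum_filter_of_ne fun w _ hw => ?_
    rw [← hperm w hw, ← hperm w hw]
    exact h
  · refine Finset.sum_eq_zero fun w hw => ?_
    by_contra h0
    rw [Finset.mem_filter, ← hperm w h0, ← hperm w h0] at hw
    exact h hw.2

theorem sum_baseChange (a : FreeAlgebra ℤ (Fin 2)) :
    baseChange R a = ((pbwBasis ℤ).repr a).sum fun s c => (c : R) • pbwElt R s := by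
  conv_lhs => rw [← (pbwBasis ℤ).linearCombination_repr a]
  rw [Finsupp.linearCombination_apply, Finsupp.sum, map_sum, Finsupp.sum]
  refine Finset.sum_congr rfl fun s _ => ?_
  rw [map_smul, pbwBasis_apply, baseChange_pbwElt, Int.cast_smul_eq_zsmul]

theorem repr_baseChange (a : FreeAlgebra ℤ (Fin 2)) (s : Multiset LyndonWord) :
    (pbwBasis R).repr (baseChange R a) s = ((pbwBasis ℤ).repr a s : R) := by
  classical
  rw [sum_baseChange, Finsupp.sum, map_sum, Finsupp.finsetSum_apply]
  simp only [← pbwBasis_apply, map_smul, Module.Basis.repr_self, Finsupp.smul_apply,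
    Finsupp.single_apply, smul_eq_mul, mul_ite, mul_one, mul_zero, Finset.sum_ite_eq']
  split_ifs with h
  · rfl
  · rw [Finsupp.notMem_support_iff.1 h, Int.cast_zero]

end Expansion

/-! ### From multisets to exponent functions, and the expansions. -/

section Exponents

theorem sort_toMultiset {α : Type*} [LinearOrder α] (T : α →₀ ℕ) :
    (Finsupp.toMultiset T).sort (· ≥ ·) =
      (T.support.sort (· ≥ ·)).flatMap fun a => List.replicate (T a) a := by
  have h1 : ((T.support.sort (· ≥ ·)).flatMap fun a => List.replicate (T a) a).Pairwise
      (· ≥ ·) := by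
    refine List.pairwise_flatMap.2 ⟨fun a _ => List.pairwise_replicate.2 (Or.inr le_rfl), ?_⟩
    refine (Finset.pairwise_sort T.support (· ≥ ·)).imp fun {a b} hab x hx y hy => ?_
    rw [List.eq_of_mem_replicate hx, List.eq_of_mem_replicate hy]
    exact hab
  have h2 : Finsupp.toMultiset T =
      (((T.support.sort (· ≥ ·)).flatMap fun a => List.replicate (T a) a : List α) :
        Multiset α) := by
    rw [← Multiset.coe_bind, Finset.sort_eq, Finsupp.toMultiset_apply, Finsupp.sum,
      Multiset.bind, Multiset.join, Finset.sum]
    congr 1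
    refine Multiset.map_congr rfl fun a _ => ?_
    rw [Multiset.nsmul_singleton, Multiset.coe_replicate]
  rw [h2, sort_coe_of_pairwise h1]

theorem decreasingProd_eq {A : Type*} [Monoid A] (f : LyndonWord → A) (T : LyndonWord →₀ ℕ) :
    decreasingProd f T = (((Finsupp.toMultiset T).sort (· ≥ ·)).map f).prod := by
  rw [decreasingProd, sort_toMultiset, List.map_flatMap, List.flatMap, List.prod_flatten,
    List.map_map]
  congr 1
  refine List.map_congr_left fun a _ => ?_
  simp

theorem lsMonomial_eq (R : Type*) [CommRing R] (T : LyndonWord →₀ ℕ) :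
    lsMonomial R T = pbwElt R (Finsupp.toMultiset T) :=
  decreasingProd_eq _ T

theorem prod_map_toMultiset {α M : Type*} [CommMonoid M] (T : α →₀ ℕ) (g : α → M) :
    ((Finsupp.toMultiset T).map g).prod = T.prod fun a n => g a ^ n := by
  rw [Finsupp.toMultiset_map, Finsupp.prod_toMultiset,
    Finsupp.prod_mapDomain_index (fun _ => pow_zero _) fun _ _ _ => pow_add _ _ _]

theorem sum_map_toMultiset {α : Type*} (T : α →₀ ℕ) (g : α → ℕ) :
    ((Finsupp.toMultiset T).map g).sum = T.sum fun a n => n * g a := by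
  induction T using Finsupp.induction_linear with
  | zero => simp
  | add S T hS hT =>
    rw [map_add, Multiset.map_add, Multiset.sum_add, hS, hT,
      Finsupp.sum_add_index' (by simp) (by intros; ring)]
  | single a n => simp [Finsupp.toMultiset_single, Multiset.map_nsmul, Multiset.sum_nsmul]

theorem letterCount_eq (x : Fin 2) (T : LyndonWord →₀ ℕ) :
    letterCount x T = (sortedWord (Finsupp.toMultiset T)).count x := by
  rw [count_sortedWord, sum_map_toMultiset, letterCount]

theorem totalLength_eq (T : LyndonWord →₀ ℕ) :
    totalLength T = (sortedWord (Finsupp.toMultiset T)).length := by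
  rw [length_sortedWord, sum_map_toMultiset, totalLength]

theorem factorialProd_eq (T : LyndonWord →₀ ℕ) :
    factorialProd T = factorialCount (Finsupp.toMultiset T) := by
  rw [factorialCount, Finsupp.toFinset_toMultiset, factorialProd, Finsupp.prod]
  simp only [Finsupp.count_toMultiset]

theorem totalLength_eq_letterCount_add (T : LyndonWord →₀ ℕ) :
    totalLength T = letterCount 1 T + letterCount 0 T := by
  rw [totalLength_eq, letterCount_eq, letterCount_eq]
  induction sortedWord (Finsupp.toMultiset T) with
  | nil => rfl
  | cons x u ih => fin_cases x <;> simp [ih] <;> omega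

theorem toMultiset_injective {α : Type*} :
    Function.Injective (Finsupp.toMultiset : (α →₀ ℕ) → Multiset α) := by
  classical
  exact Multiset.toFinsupp.symm.injective

/-- Exponent functions inject into words, and the alphabet is finite. -/
theorem finite_totalLength_eq (d : ℕ) : {T | totalLength T = d}.Finite := by
  refine Set.Finite.of_finite_image (f := fun T => sortedWord (Finsupp.toMultiset T))
    ((List.finite_length_eq (Fin 2) d).subset ?_)
    ((wordEquiv.symm.injective.comp toMultiset_injective).injOn)
  rintro _ ⟨T, hT, rfl⟩
  exact (totalLength_eq T).symm.trans hT

theorem finite_letterCount_eq (i j : ℕ) :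
    {T | letterCount 1 T = i ∧ letterCount 0 T = j}.Finite := by
  refine (finite_totalLength_eq (i + j)).subset ?_
  rintro T ⟨rfl, rfl⟩
  exact totalLength_eq_letterCount_add T

theorem baseChange_eq_finsum (R : Type*) [CommRing R] {a : FreeAlgebra ℤ (Fin 2)}
    {S : Set (LyndonWord →₀ ℕ)} (hS : S.Finite)
    (h1 : ∀ T ∈ S, (pbwBasis ℤ).repr a (Finsupp.toMultiset T) = powCoeff (Finsupp.toMultiset T))
    (h2 : ∀ T ∉ S, (pbwBasis ℤ).repr a (Finsupp.toMultiset T) = 0) :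
    baseChange R a =
      ∑ᶠ T ∈ S, ((powCoeff (Finsupp.toMultiset T)).toNat : R) • lsMonomial R T := by
  classical
  rw [finsum_mem_eq_finite_toFinset_sum _ hS, sum_baseChange,
    Finsupp.sum_of_support_subset (s := hS.toFinset.image Finsupp.toMultiset) _ ?_ _ (by simp),
    Finset.sum_image toMultiset_injective.injOn]
  · refine Finset.sum_congr rfl fun T hT => ?_
    rw [h1 T (hS.mem_toFinset.1 hT), lsMonomial_eq, ← Int.cast_natCast,
      Int.toNat_of_nonneg (powCoeff_nonneg _)]
  · intro s hs
    obtain ⟨T, rfl⟩ : ∃ T : LyndonWord →₀ ℕ, Finsupp.toMultiset T = s :=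
      Multiset.toFinsupp.symm.surjective s
    rw [Finsupp.mem_support_iff] at hs
    refine Finset.mem_image_of_mem _ (hS.mem_toFinset.2 ?_)
    by_contra hT
    exact hs (h2 T hT)

theorem decreasingProd_smul {k A : Type*} [CommSemiring k] [Semiring A] [Algebra k A]
    (c : LyndonWord → k) (f : LyndonWord → A) (T : LyndonWord →₀ ℕ) :
    decreasingProd (fun α => c α • f α) T =
      (T.prod fun α t => c α ^ t) • decreasingProd f T := by
  have h : ∀ l : List LyndonWord, (l.map fun α => (c α • f α) ^ T α).prod =
      (l.map fun α => c α ^ T α).prod • (l.map fun α => f α ^ T α).prod := by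
    intro l
    induction l with
    | nil => simp
    | cons α l ih =>
      rw [List.map_cons, List.prod_cons, ih, smul_pow, smul_mul_smul_comm]
      rfl
  have h1 : ((T.support.sort (· ≥ ·)).map fun α => c α ^ T α).prod =
      T.prod fun α t => c α ^ t := by
    rw [← Multiset.prod_coe, ← Multiset.map_coe, Finset.sort_eq]
    rfl
  rw [decreasingProd, h, h1, decreasingProd]

theorem lsSH_eq_finsum (R : Type*) [CommRing R] (i j : ℕ) :
    lsSH R i j = ∑ᶠ T ∈ {T | letterCount 1 T = i ∧ letterCount 0 T = j},
      ((powCoeff (Finsupp.toMultiset T)).toNat : R) • lsMonomial R T := by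
  rw [← baseChange_lsSH]
  refine baseChange_eq_finsum R (finite_letterCount_eq i j) (fun T hT => ?_) fun T hT => ?_ <;>
  · simp only [Set.mem_ofPred_eq, letterCount_eq] at hT
    simp [repr_lsSH, hT]

theorem letterSum_pow_eq_finsum (R : Type*) [CommRing R] (d : ℕ) :
    (lsE R [0] + lsE R [1]) ^ d = ∑ᶠ T ∈ {T | totalLength T = d},
      ((powCoeff (Finsupp.toMultiset T)).toNat : R) • lsMonomial R T := by
  have h : lsE R [0] + lsE R [1] = baseChange R (letterSum ℤ) := by
    rw [baseChange_letterSum, lsE_singleton, lsE_singleton, letterSum]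
  rw [h, ← map_pow]
  refine baseChange_eq_finsum R (finite_totalLength_eq d) (fun T hT => ?_) fun T hT => ?_ <;>
  · simp only [Set.mem_ofPred_eq, totalLength_eq] at hT
    simp [repr_letterSum_pow, hT]

end Exponents

end LyndonShirshov

/-! ### The main theorem. -/

open LyndonShirshov in
theorem mainTheorem8 (k : Type*) [Field k] :
    ∃ (C : LyndonWord → ℕ) (N : (LyndonWord →₀ ℕ) → ℕ),
      -- `C` is given by the recursion, and `N` is the normalized coefficient (a natural number)
      (∀ α, (C α : ℚ) = lsConst α.1) ∧
      (∀ T, (N T : ℚ) = ((totalLength T) ! : ℚ) / (factorialProd T : ℚ) *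
        T.prod fun α t => ((C α : ℚ) / (α.1.length ! : ℚ)) ^ t) ∧
      -- the ordered monomials form a basis, and `C α` is the coefficient of `E_α`
      (∃ b : Module.Basis (LyndonWord →₀ ℕ) k (FreeAlgebra k (Fin 2)),
        (∀ T, b T = lsMonomial k T) ∧
        ∀ α : LyndonWord,
          b.repr (lsSH k (α.1.count 1) (α.1.count 0)) (Finsupp.single α 1) = (C α : k)) ∧
      -- the expansions over an arbitrary field
      (∀ i j : ℕ, {T | letterCount 1 T = i ∧ letterCount 0 T = j}.Finite ∧
        lsSH k i j =
          ∑ᶠ T ∈ {T | letterCount 1 T = i ∧ letterCount 0 T = j}, (N T : k) • lsMonomial k T) ∧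
      (∀ d : ℕ, {T | totalLength T = d}.Finite ∧
        (lsE k [0] + lsE k [1]) ^ d =
          ∑ᶠ T ∈ {T | totalLength T = d}, (N T : k) • lsMonomial k T) ∧
      -- the normalized expansions, where the factorials are invertible
      (CharZero k →
        (∀ i j : ℕ, lsSH k i j =
          ∑ᶠ T ∈ {T | letterCount 1 T = i ∧ letterCount 0 T = j},
            (((i + j) ! : k) / (factorialProd T : k)) •
              decreasingProd (fun α => ((C α : k) / (α.1.length ! : k)) • lsE k α.1) T) ∧
        (∀ d : ℕ, (lsE k [0] + lsE k [1]) ^ d =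
          ∑ᶠ T ∈ {T | totalLength T = d},
            ((d ! : k) / (factorialProd T : k)) •
              decreasingProd (fun α => ((C α : k) / (α.1.length ! : k)) • lsE k α.1) T)) := by
  have hcast : ∀ s, ((powCoeff s).toNat : ℤ) = powCoeff s := fun s =>
    Int.toNat_of_nonneg (powCoeff_nonneg s)
  have hcastQ : ∀ s, ((powCoeff s).toNat : ℚ) = (powCoeff s : ℚ) := fun s => by
    exact_mod_cast congrArg (Int.cast : ℤ → ℚ) (hcast s)
  have hN : ∀ T : LyndonWord →₀ ℕ, ((powCoeff (Finsupp.toMultiset T)).toNat : ℚ) =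
      ((totalLength T) ! : ℚ) / (factorialProd T : ℚ) *
        T.prod fun α t => (((powCoeff {α}).toNat : ℚ) / (α.1.length ! : ℚ)) ^ t := fun T => by
    rw [hcastQ, powCoeff_eq, totalLength_eq, factorialProd_eq, prod_map_toMultiset]
    simp only [hcastQ]
  have hterm : CharZero k → ∀ T : LyndonWord →₀ ℕ,
      ((powCoeff (Finsupp.toMultiset T)).toNat : k) • lsMonomial k T =
        (((totalLength T) ! : k) / (factorialProd T : k)) •
          decreasingProd (fun α => (((powCoeff {α}).toNat : k) / (α.1.length ! : k)) • lsE k α.1)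
            T := by
    intro _ T
    -- In characteristic zero the rational formula for the coefficient can be cast to `k`, and the
    -- scalars are then gathered in front of the monomial.
    have h := congrArg (Rat.cast : ℚ → k) (hN T)
    simp only [Finsupp.prod] at h
    push_cast at h
    rw [decreasingProd_smul, smul_smul, h]
    rfl
  refine ⟨fun α => (powCoeff {α}).toNat, fun T => (powCoeff (Finsupp.toMultiset T)).toNat,
    fun α => ?_, hN, ⟨(pbwBasis k).reindex Multiset.toFinsupp.toEquiv, fun T => ?_, fun α => ?_⟩,
    fun i j => ⟨finite_letterCount_eq i j, lsSH_eq_finsum k i j⟩,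
    fun d => ⟨finite_totalLength_eq d, letterSum_pow_eq_finsum k d⟩,
    fun h0 => ⟨fun i j => ?_, fun d => ?_⟩⟩
  · rw [hcastQ, powCoeff_singleton]
  · rw [Module.Basis.reindex_apply, pbwBasis_apply, lsMonomial_eq]
    rfl
  · have hα : Multiset.toFinsupp.toEquiv.symm (Finsupp.single α 1) = {α} :=
      (Finsupp.toMultiset_single α 1).trans (one_nsmul _)
    rw [Module.Basis.repr_reindex_apply, hα, ← baseChange_lsSH, repr_baseChange, repr_lsSH,
      sortedWord_singleton, if_pos ⟨rfl, rfl⟩, ← hcast, Int.cast_natCast]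
  · rw [lsSH_eq_finsum]
    refine finsum_mem_congr rfl fun T hT => ?_
    rw [hterm h0, totalLength_eq_letterCount_add, hT.1, hT.2]
  · rw [letterSum_pow_eq_finsum]
    refine finsum_mem_congr rfl fun T hT => ?_
    rw [hterm h0, show totalLength T = d from hT]
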